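/- For a real number $t$ write $[t]$ for the largest integer $\le t$, write $(a,b)$ for the greatest common divisor of integers $a,b$, and let $\zeta$ be the Riemann zeta function. For real $c\ge 1$ and $x\ge 1$ let $$S_c(x)=\#\{(m,n)\in\mathbb{Z}_{\ge 1}^2 : m,n\le x,\ ([m^c],[n^c])=1\}.$$ **Theorem.** Let $k\ge 2$ be an integer and let $c$ be a real number with $1\le c<k$. Then for all real $x\ge 1$, $$S_c(x)=\frac{1}{\zeta(2)}x^2+O\Bigl(x^{2-\frac{k-c}{2^k-1}}\Bigr),$$ where the implicit constant depends only on $c$ and $k$. Consequently, for every real $c\ge 1$ and all real $x\ge 1$, $$S_c(x)=\frac{1}{\zeta(2)}x^2+O\Bigl(x^{2-2^{-(\lceil c\rceil+1)}}\Bigr),$$ where the implicit constant depends only on $c$. -/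

import Mathlib

/-- The `n`-th term `[n ^ c]` of the Piatetski-Shapiro sequence of order `c`. -/
noncomputable def piatetskiShapiro (c : ℝ) (n : ℕ) : ℕ := ⌊(n : ℝ) ^ c⌋₊

/-- The number of pairs of positive integers `m, n ≤ x` such that `[m ^ c]` and `[n ^ c]` are
relatively prime. -/
noncomputable def coprimePairCount (c x : ℝ) : ℕ :=
  ((Finset.Icc 1 ⌊x⌋₊ ×ˢ Finset.Icc 1 ⌊x⌋₊).filter fun p : ℕ × ℕ =>
    Nat.Coprime (piatetskiShapiro c p.1) (piatetskiShapiro c p.2)).card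

/-!
Write `N_d(X)` for the number of `n ≤ X` with `d ∣ [n ^ c]` (`divCount`). Möbius inversion gives
`S_c(X) = ∑_{d ≤ X ^ c} μ(d) N_d(X)²`, so the theorem amounts to `N_d(X)` being close to `X / d`,
uniformly in `d`.

Since `d ∣ [y]` means `{y / d} < 1 / d`, the difference `N_d(X) - X / d` is a difference of two sums
of the sawtooth function `ψ(t) = {t} - 1/2`, along `n ^ c / d` and a translate of it. Averaging `ψ`
over an interval of length `1 / H` turns it into a difference quotient of the periodic Bernoulli
function `B₂`, whose Fourier series converges absolutely; this bounds the sums of `ψ` by the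
exponential sums `∑ e(h n ^ c / d)` (`abs_sum_sawtooth_le`).

The exponential sums are handled by van der Corput's method, in an entirely discrete form. A phase
on a block of length at most `N` is regular with parameter `T` if its `j`-th differences have
constant sign and size `T / N ^ j`, for *all* `1 ≤ j ≤ k` (`HasRegularDiffs`). On `N ≤ n < 2N`,
the phase `h n ^ c / d` with `c` not an integer is regular with `T = h N ^ c / d`. With
`K = 2 ^ (k - 1)`, the sum over a regular phase is, for `T ≥ √N`,
`≪ N ((T / N ^ k) ^ (1 / (2K - 2)) + N ^ (-1 / K))` (`exists_bound_regular`).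
For `k = 2` this follows from the Kusmin–Landau inequality and the second derivative test, and one
Weyl differencing step, which maps regular phases to regular phases, leads from `k` to `k + 1`.
Because the lower differences are controlled as well, the second term does not depend on `T`, and so
the estimate is uniform in `h` and `d`. It leads to
`N_d(X) - X / d ≪ X ^ (1 - δ) d ^ (-θ) + X ^ (1 - 1 / K + ε)` with `δ = (k - c) / (2K - 1)` and
`θ = 1 / (2K - 1)` (`exists_divCount_bound`). Blocks with `N ^ c / d < √N` are
trivial: there both the count and its expected value are of order at most `√N`.

If `k - c < 2 - 1 / K` then `δ < 1 / K` and the second term is smaller than `X ^ (1 - δ)` by a power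
of `X`. Then `∑_d |N_d² - (X / d)²|` is `≪ X ^ (2 - δ)`: small `d` are treated by equidistribution
once more, and for large `d` the saving, a power of `X`, outweighs the divisor bound
`∑_d N_d ≪ X ^ (1 + ε)` (`exists_coprimePairCount_bound_nat`). If `k - c ≥ 2 - 1 / K`, the claim for
`k` is weaker than the claim for `k - 1` (`coprimeAsymptotic_nonintegral`).

For integral `c` the differences of high order vanish, but then `[m ^ c]` and `[n ^ c]` are coprime
exactly when `m` and `n` are, and `c = 1`, where `|N_d(X) - X / d| ≤ 1`, covers this case. The
second claim is the first one for `k = ⌈c⌉ + 1`.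
-/

open Finset

/-! ### Exponential sums: the Kusmin–Landau inequality and the second derivative test -/

/-- The additive character `e(t) = exp(2πit)`. -/
noncomputable def unitExp (t : ℝ) : ℂ := Complex.exp (2 * Real.pi * t * Complex.I)

lemma unitExp_add (s t : ℝ) : unitExp (s + t) = unitExp s * unitExp t := by
  rw [unitExp, unitExp, unitExp, ← Complex.exp_add]; congr 1; push_cast; ring

lemma norm_unitExp (t : ℝ) : ‖unitExp t‖ = 1 := by
  have := Complex.norm_exp_ofReal_mul_I (2 * Real.pi * t)
  rw [unitExp]; push_cast at this; exact this

lemma unitExp_eq (t : ℝ) : unitExp t =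
    Real.cos (2 * Real.pi * t) + Real.sin (2 * Real.pi * t) * Complex.I := by
  rw [unitExp, ← Complex.ofReal_ofNat, ← Complex.ofReal_mul, ← Complex.ofReal_mul,
    Complex.exp_mul_I, Complex.ofReal_cos, Complex.ofReal_sin]

lemma unitExp_int (m : ℤ) : unitExp m = 1 := by
  rw [unitExp]; convert Complex.exp_int_mul_two_pi_mul_I m using 2; push_cast; ring

lemma conj_unitExp (t : ℝ) : (starRingEnd ℂ) (unitExp t) = unitExp (-t) := by
  rw [unitExp_eq, unitExp_eq]
  simp [Real.sin_neg, Real.cos_neg, mul_neg, -Complex.ofReal_cos, -Complex.ofReal_sin]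

lemma unitExp_re (t : ℝ) : (unitExp t).re = Real.cos (2 * Real.pi * t) := by
  rw [unitExp_eq]; simp [-Complex.ofReal_cos, -Complex.ofReal_sin]

/-- `1 / (e(t) - 1) = -1/2 - (i/2) cot(πt)`, cleared of denominators. -/
lemma cot_mul_unitExp_sub_one {t : ℝ} (ht : Real.sin (Real.pi * t) ≠ 0) :
    (-1 / 2 - (Real.cos (Real.pi * t) / Real.sin (Real.pi * t) : ℝ) / 2 * Complex.I) *
      (unitExp t - 1) = 1 := by
  rw [unitExp_eq, mul_assoc, Real.cos_two_mul, Real.sin_two_mul]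
  have h2 := Real.sin_sq_add_cos_sq (Real.pi * t)
  set s := Real.sin (Real.pi * t)
  set u := Real.cos (Real.pi * t)
  have h3 : (u : ℂ) ^ 2 = 1 - (s : ℂ) ^ 2 := by
    rw [← Complex.ofReal_pow, ← Complex.ofReal_pow, ← Complex.ofReal_one, ← Complex.ofReal_sub]
    congr 1; linarith
  have hs : (s : ℂ) ≠ 0 := by exact_mod_cast ht
  push_cast
  field_simp
  linear_combination (-2 * Complex.I * u) * h3 - 2 * s * u ^ 2 * Complex.I_sq

lemma two_mul_le_sin_pi {D t : ℝ} (h1 : D ≤ t) (h2 : t ≤ 1 - D) (hD : 0 ≤ D) :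
    2 * D ≤ Real.sin (Real.pi * t) := by
  have hpi := Real.pi_pos
  rcases le_total t (1 / 2) with h | h
  · have := Real.mul_le_sin (x := Real.pi * t) (by nlinarith) (by nlinarith)
    have h4 : 2 / Real.pi * (Real.pi * t) = 2 * t := by field_simp
    linarith
  · have := Real.mul_le_sin (x := Real.pi - Real.pi * t) (by nlinarith) (by nlinarith)
    have h4 : 2 / Real.pi * (Real.pi - Real.pi * t) = 2 * (1 - t) := by field_simp
    rw [Real.sin_pi_sub] at this
    linarith

lemma cot_anti {s t : ℝ} (hs : 0 < s) (hst : s ≤ t) (ht : t < 1) :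
    Real.cos (Real.pi * t) / Real.sin (Real.pi * t) ≤
      Real.cos (Real.pi * s) / Real.sin (Real.pi * s) := by
  have hpi := Real.pi_pos
  have h1 : 0 < Real.sin (Real.pi * s) :=
    Real.sin_pos_of_pos_of_lt_pi (by positivity) (by nlinarith)
  have h2 : 0 < Real.sin (Real.pi * t) :=
    Real.sin_pos_of_pos_of_lt_pi (mul_pos hpi (by linarith)) (by nlinarith)
  have h3 : 0 ≤ Real.sin (Real.pi * t - Real.pi * s) :=
    Real.sin_nonneg_of_nonneg_of_le_pi (by nlinarith) (by nlinarith)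
  rw [Real.sin_sub] at h3
  rw [div_le_div_iff₀ h2 h1]
  linarith

/-- Kusmin–Landau for phases whose first differences increase and stay in `[D, 1 - D]`. -/
lemma kusmin_landau_aux (f : ℕ → ℝ) {D : ℝ} (hD : 0 < D) (L : ℕ)
    (hmono : ∀ n, n + 1 < L → f (n + 1) - f n ≤ f (n + 2) - f (n + 1))
    (h1 : ∀ n, n < L → D ≤ f (n + 1) - f n) (h2 : ∀ n, n < L → f (n + 1) - f n ≤ 1 - D) :
    ‖∑ n ∈ range L, unitExp (f n)‖ ≤ 1 / D := by
  rcases Nat.eq_zero_or_pos L with rfl | hL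
  · simp; exact hD.le
  set g : ℕ → ℝ := fun n => f (n + 1) - f n with hg
  set ct : ℕ → ℝ := fun n => Real.cos (Real.pi * g n) / Real.sin (Real.pi * g n) with hct
  set w : ℕ → ℂ := fun n => -1 / 2 - (ct n : ℝ) / 2 * Complex.I with hw
  have hsin : ∀ n, n < L → 2 * D ≤ Real.sin (Real.pi * g n) := fun n hn =>
    two_mul_le_sin_pi (h1 n hn) (h2 n hn) hD.le
  have hwu : ∀ n, n < L → unitExp (f n) = w n * (unitExp (f (n + 1)) - unitExp (f n)) := by
    intro n hn
    have := cot_mul_unitExp_sub_one (t := g n) (by have := hsin n hn; linarith)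
    have h3 : f (n + 1) = f n + g n := by simp [hg]
    rw [h3, unitExp_add]
    simp only [hw, hct]
    linear_combination (-unitExp (f n)) * this
  -- the partial sum differs from the boundary terms by the variation of the cotangent
  have key : ∀ q, q + 1 ≤ L → ‖∑ n ∈ range (q + 1), unitExp (f n) -
      (w q * unitExp (f (q + 1)) - w 0 * unitExp (f 0))‖ ≤ (ct 0 - ct q) / 2 := by
    intro q
    induction q with
    | zero =>
      intro h
      rw [zero_add, sum_range_one]
      have := hwu 0 h
      rw [zero_add] at this
      have h0 : unitExp (f 0) - (w 0 * unitExp (f 1) - w 0 * unitExp (f 0)) = 0 := by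
        linear_combination this
      simp [h0]
    | succ q ih =>
      intro h
      have h3 := ih (by omega)
      have h4 := hwu (q + 1) (by omega)
      have hdec : ct (q + 1) ≤ ct q := by
        apply cot_anti
        · exact hD.trans_le (h1 q (by omega))
        · exact hmono q (by omega)
        · have := h2 (q + 1) (by omega)
          simp only [hg]; linarith
      have hwd : ‖(w q - w (q + 1)) * unitExp (f (q + 1))‖ = (ct q - ct (q + 1)) / 2 := by
        rw [norm_mul, norm_unitExp, mul_one]
        have : w q - w (q + 1) = ((-(ct q - ct (q + 1)) / 2 : ℝ) : ℂ) * Complex.I := by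
          simp only [hw]; push_cast; ring
        rw [this, norm_mul, Complex.norm_I, mul_one, Complex.norm_real, Real.norm_eq_abs,
          neg_div, abs_neg, abs_of_nonneg (by linarith)]
      rw [sum_range_succ]
      have h5 : ∑ n ∈ range (q + 1), unitExp (f n) + unitExp (f (q + 1)) -
          (w (q + 1) * unitExp (f (q + 1 + 1)) - w 0 * unitExp (f 0)) =
          (∑ n ∈ range (q + 1), unitExp (f n) -
          (w q * unitExp (f (q + 1)) - w 0 * unitExp (f 0))) +
          (w q - w (q + 1)) * unitExp (f (q + 1)) := by
        linear_combination h4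
      rw [h5]
      refine (norm_add_le _ _).trans ?_
      rw [hwd]; linarith
  obtain ⟨q, rfl⟩ : ∃ q, L = q + 1 := ⟨L - 1, by omega⟩
  have hc : ∀ n, n < q + 1 → |ct n| ≤ 1 / (2 * D) := by
    intro n hn
    have h3 := hsin n hn
    simp only [hct]
    rw [abs_div, abs_of_pos (a := Real.sin _) (by linarith)]
    exact div_le_div₀ zero_le_one (Real.abs_cos_le_one _) (by linarith) h3
  have hwn : ∀ n, n < q + 1 → ‖w n‖ ≤ 1 / (4 * D) := by
    intro n hn
    have h3 := hsin n hn
    have h4 : ‖w n‖ ^ 2 = (1 / (2 * Real.sin (Real.pi * g n))) ^ 2 := by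
      have h0 : Complex.normSq (w n) = 1 / 4 + ct n ^ 2 / 4 := by
        rw [Complex.normSq_apply]; simp [hw]; ring
      rw [← Complex.normSq_eq_norm_sq, h0]
      simp only [hct]
      have h5 := Real.sin_sq_add_cos_sq (Real.pi * g n)
      have : Real.sin (Real.pi * g n) ≠ 0 := by linarith
      field_simp
      linarith
    have h6 : ‖w n‖ = 1 / (2 * Real.sin (Real.pi * g n)) := by
      rwa [sq_eq_sq₀ (norm_nonneg _) (by have : 0 < Real.sin (Real.pi * g n) := by linarith
                                         positivity)] at h4
    rw [h6]
    apply one_div_le_one_div_of_le <;> linarith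
  have h6 := key q le_rfl
  have h7 := abs_le.1 (hc 0 (by omega))
  have h8 := abs_le.1 (hc q (by omega))
  have h9 : ‖w q * unitExp (f (q + 1)) - w 0 * unitExp (f 0)‖ ≤ 1 / (4 * D) + 1 / (4 * D) := by
    refine (norm_sub_le _ _).trans ?_
    rw [norm_mul, norm_mul, norm_unitExp, norm_unitExp, mul_one, mul_one]
    exact add_le_add (hwn q (by omega)) (hwn 0 (by omega))
  have h10 := norm_add_le (∑ n ∈ range (q + 1), unitExp (f n) -
      (w q * unitExp (f (q + 1)) - w 0 * unitExp (f 0)))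
      (w q * unitExp (f (q + 1)) - w 0 * unitExp (f 0))
  rw [sub_add_cancel] at h10
  have e1 : 1 / (4 * D) = 1 / D / 4 := by field_simp
  have e2 : 1 / (2 * D) = 1 / D / 2 := by field_simp
  rw [e1] at h9
  rw [e2] at h7 h8
  linarith

lemma unitExp_add_int (t : ℝ) (m : ℤ) : unitExp (t + m) = unitExp t := by
  rw [unitExp_add, unitExp_int, mul_one]

lemma norm_sum_unitExp_neg (f : ℕ → ℝ) (s : Finset ℕ) :
    ‖∑ n ∈ s, unitExp (-f n)‖ = ‖∑ n ∈ s, unitExp (f n)‖ := by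
  rw [← Complex.norm_conj (∑ n ∈ s, unitExp (f n)), map_sum]
  simp only [conj_unitExp]

lemma norm_sum_unitExp_le (f : ℕ → ℝ) (s : Finset ℕ) : ‖∑ n ∈ s, unitExp (f n)‖ ≤ #s := by
  refine (norm_sum_le _ _).trans ?_
  simp [norm_unitExp]

/-- The Kusmin–Landau inequality: if the first differences of the phase increase and keep a distance
at least `D` from the integers, the exponential sum is at most `1 / D`. -/
lemma kusmin_landau (f : ℕ → ℝ) {D : ℝ} (hD : 0 < D) (m : ℤ) (p q : ℕ)
    (hmono : ∀ n, p ≤ n → n + 1 < q → f (n + 1) - f n ≤ f (n + 2) - f (n + 1))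
    (h1 : ∀ n, p ≤ n → n < q → m + D ≤ f (n + 1) - f n)
    (h2 : ∀ n, p ≤ n → n < q → f (n + 1) - f n ≤ m + 1 - D) :
    ‖∑ n ∈ Ico p q, unitExp (f n)‖ ≤ 1 / D := by
  have h : ∑ n ∈ Ico p q, unitExp (f n) =
      ∑ n ∈ range (q - p), unitExp (f (p + n) - m * n) := by
    rw [sum_Ico_eq_sum_range]
    refine sum_congr rfl fun n _ => ?_
    have := unitExp_add_int (f (p + n) - m * n) (m * n)
    rw [← this]; congr 1; push_cast; ring
  rw [h]
  apply kusmin_landau_aux (fun n => f (p + n) - m * n) hD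
  · intro n hn
    have := hmono (p + n) (by omega) (by omega)
    push_cast
    simp only [← add_assoc]
    linarith
  · intro n hn
    have := h1 (p + n) (by omega) (by omega)
    push_cast
    simp only [← add_assoc]
    linarith
  · intro n hn
    have := h2 (p + n) (by omega) (by omega)
    push_cast
    simp only [← add_assoc]
    linarith

lemma filter_range_eq_Ico (g : ℕ → ℝ) (M : ℕ) (hg : ∀ i j, i ≤ j → j < M → g i ≤ g j) (u v : ℝ) :
    ∃ p q, p ≤ q ∧ q ≤ M ∧ (range M).filter (fun n => u ≤ g n ∧ g n ≤ v) = Ico p q := by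
  rcases ((range M).filter (fun n => u ≤ g n ∧ g n ≤ v)).eq_empty_or_nonempty with h | h
  · exact ⟨0, 0, le_rfl, Nat.zero_le _, by rw [h]; simp⟩
  · set s := (range M).filter (fun n => u ≤ g n ∧ g n ≤ v) with hs
    have h1 := s.min'_mem h
    have h2 := s.max'_mem h
    have h3 := s.min'_le _ h2
    have hmem : ∀ n, n ∈ s ↔ n < M ∧ u ≤ g n ∧ g n ≤ v := by
      intro n; rw [hs, mem_filter, mem_range]
    have h1' := (hmem _).1 h1
    have h2' := (hmem _).1 h2
    refine ⟨s.min' h, s.max' h + 1, by omega, by omega, ?_⟩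
    ext n
    rw [mem_Ico]
    constructor
    · intro hn
      exact ⟨s.min'_le _ hn, Nat.lt_succ_of_le (s.le_max' _ hn)⟩
    · rintro ⟨h4, h5⟩
      rw [hmem]
      exact ⟨by omega, h1'.2.1.trans (hg _ _ h4 (by omega)),
        (hg _ _ (by omega) h2'.1).trans h2'.2.2⟩

lemma card_filter_le_of_spacing (g : ℕ → ℝ) (M : ℕ) {lo : ℝ} (hlo : 0 < lo)
    (hg : ∀ i j, i ≤ j → j < M → lo * ((j : ℝ) - i) ≤ g j - g i) (u v : ℝ) (huv : u ≤ v) :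
    (#((range M).filter (fun n => u ≤ g n ∧ g n ≤ v)) : ℝ) ≤ (v - u) / lo + 1 := by
  obtain ⟨p, q, hpq, hq, h⟩ := filter_range_eq_Ico g M (fun i j hij hj => by
    have := hg i j hij hj
    have h2 : (i : ℝ) ≤ j := by exact_mod_cast hij
    nlinarith) u v
  have h0 : 0 ≤ (v - u) / lo := div_nonneg (by linarith) hlo.le
  rw [h, Nat.card_Ico]
  rcases hpq.eq_or_lt with rfl | hlt
  · simp; linarith
  · have hp : p ∈ (range M).filter (fun n => u ≤ g n ∧ g n ≤ v) := by
      rw [h, mem_Ico]; omega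
    have hq : q - 1 ∈ (range M).filter (fun n => u ≤ g n ∧ g n ≤ v) := by
      rw [h, mem_Ico]; omega
    rw [mem_filter, mem_range] at hp hq
    have h1 := hg p (q - 1) (by omega) hq.1
    have h2 : lo * (((q - 1 : ℕ) : ℝ) - p) ≤ v - u := by linarith [hp.2.1, hq.2.2]
    rw [Nat.cast_sub hpq]
    rw [Nat.cast_sub (by omega), Nat.cast_one] at h2
    have : (q : ℝ) - 1 - p ≤ (v - u) / lo := by
      rw [le_div_iff₀ hlo]; linarith
    linarith

/-- The second derivative test, in discrete form. The range of the first difference is cut at the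
integers; away from them Kusmin–Landau applies, and within `D` of an integer terms are counted. -/
lemma second_difference_test (f : ℕ → ℝ) (L : ℕ) {lo hi D : ℝ} (hlo : 0 < lo) (hD : 0 < D)
    (h1 : ∀ n, n + 2 < L → lo ≤ (f (n + 2) - f (n + 1)) - (f (n + 1) - f n))
    (h2 : ∀ n, n + 2 < L → (f (n + 2) - f (n + 1)) - (f (n + 1) - f n) ≤ hi) :
    ‖∑ n ∈ range L, unitExp (f n)‖ ≤ (L * |hi| + 2) * (1 / D + 2 * (D / lo + 1)) + 1 := by
  rcases Nat.eq_zero_or_pos L with rfl | hL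
  · simp; positivity
  obtain ⟨M, rfl⟩ : ∃ M, L = M + 1 := ⟨L - 1, by omega⟩
  have hpos : 0 ≤ 1 / D + 2 * (D / lo + 1) := by positivity
  set g : ℕ → ℝ := fun n => f (n + 1) - f n with hg
  have hlow : ∀ i j, i ≤ j → j < M → lo * ((j : ℝ) - i) ≤ g j - g i := by
    intro i j hij
    induction j, hij using Nat.le_induction with
    | base => intro _; simp
    | succ j hij ih =>
      intro hj
      have h3 := ih (by omega)
      have h4 := h1 j (by omega)
      simp only [hg] at h3 ⊢
      push_cast
      linarith
  have hmono : ∀ i j, i ≤ j → j < M → g i ≤ g j := by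
    intro i j hij hj
    have := hlow i j hij hj
    have h2 : (i : ℝ) ≤ j := by exact_mod_cast hij
    nlinarith
  have hupp : ∀ j, j < M → g j - g 0 ≤ |hi| * j := by
    intro j
    induction j with
    | zero => intro _; simp
    | succ j ih =>
      intro hj
      have h3 := ih (by omega)
      have h4 := (h2 j (by omega)).trans (le_abs_self hi)
      simp only [hg] at h3 ⊢
      push_cast
      linarith
  rw [sum_range_succ]
  refine (norm_add_le _ _).trans (add_le_add ?_ (norm_unitExp _).le)
  rcases Nat.eq_zero_or_pos M with rfl | hM
  · simp; positivity
  have hmaps : ∀ n ∈ range M, ⌊g n⌋ ∈ Finset.Icc ⌊g 0⌋ ⌊g (M - 1)⌋ := by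
    intro n hn
    rw [mem_range] at hn
    rw [Finset.mem_Icc]
    exact ⟨Int.floor_le_floor (hmono 0 n (by omega) hn),
      Int.floor_le_floor (hmono n (M - 1) (by omega) (by omega))⟩
  rw [← sum_fiberwise_of_maps_to hmaps]
  refine (norm_sum_le _ _).trans ?_
  have hfib : ∀ m ∈ Finset.Icc ⌊g 0⌋ ⌊g (M - 1)⌋,
      ‖∑ n ∈ range M with ⌊g n⌋ = m, unitExp (f n)‖ ≤ 1 / D + 2 * (D / lo + 1) := by
    intro m _
    rw [← sum_filter_add_sum_filter_not _ (fun n => m + D ≤ g n ∧ g n ≤ m + 1 - D)]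
    refine (norm_add_le _ _).trans (add_le_add ?_ ?_)
    · rw [filter_filter]
      have : (range M).filter (fun n => ⌊g n⌋ = m ∧ m + D ≤ g n ∧ g n ≤ m + 1 - D) =
          (range M).filter (fun n => m + D ≤ g n ∧ g n ≤ m + 1 - D) := by
        ext n
        simp only [mem_filter]
        refine ⟨fun h => ⟨h.1, h.2.2⟩, fun h => ⟨h.1, ?_, h.2⟩⟩
        rw [Int.floor_eq_iff]
        constructor <;> linarith [h.2.1, h.2.2]
      rw [this]
      obtain ⟨p, q, hpq, hq, h⟩ := filter_range_eq_Ico g M hmono (m + D) (m + 1 - D)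
      have hmem : ∀ n, p ≤ n → n < q → m + D ≤ g n ∧ g n ≤ m + 1 - D := by
        intro n hn1 hn2
        have : n ∈ Ico p q := by rw [mem_Ico]; exact ⟨hn1, hn2⟩
        rw [← h, mem_filter] at this
        exact this.2
      rw [h]
      apply kusmin_landau f hD m p q
      · intro n _ hn2
        exact hmono n (n + 1) (by omega) (by omega)
      · exact fun n a b => (hmem n a b).1
      · exact fun n a b => (hmem n a b).2
    · refine (norm_sum_unitExp_le _ _).trans ?_
      have hsub : ((range M).filter (fun n => ⌊g n⌋ = m)).filter
            (fun n => ¬ (m + D ≤ g n ∧ g n ≤ m + 1 - D)) ⊆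
          (range M).filter (fun n => (m : ℝ) ≤ g n ∧ g n ≤ m + D) ∪
          (range M).filter (fun n => m + 1 - D ≤ g n ∧ g n ≤ m + 1) := by
        intro n
        simp only [mem_filter, mem_union, not_and_or, not_le]
        rintro ⟨⟨hn, hfl⟩, h⟩
        rw [Int.floor_eq_iff] at hfl
        rcases h with h | h
        · exact Or.inl ⟨hn, hfl.1, h.le⟩
        · exact Or.inr ⟨hn, h.le, hfl.2.le⟩
      have h3 : (#(((range M).filter (fun n => ⌊g n⌋ = m)).filter
            (fun n => ¬ (m + D ≤ g n ∧ g n ≤ m + 1 - D))) : ℝ) ≤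
          (#((range M).filter (fun n => (m : ℝ) ≤ g n ∧ g n ≤ m + D)) : ℝ) +
          #((range M).filter (fun n => m + 1 - D ≤ g n ∧ g n ≤ m + 1)) := by
        exact_mod_cast (card_le_card hsub).trans (card_union_le _ _)
      have h4 := card_filter_le_of_spacing g M hlo hlow m (m + D) (by linarith)
      have h5 := card_filter_le_of_spacing g M hlo hlow (m + 1 - D) (m + 1) (by linarith)
      rw [show (m : ℝ) + D - m = D by ring] at h4
      rw [show (m : ℝ) + 1 - (m + 1 - D) = D by ring] at h5
      linarith
  refine (sum_le_sum hfib).trans ?_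
  rw [sum_const, nsmul_eq_mul, Int.card_Icc]
  refine mul_le_mul_of_nonneg_right ?_ hpos
  have h3 : ⌊g 0⌋ ≤ ⌊g (M - 1)⌋ := Int.floor_le_floor (hmono 0 _ (by omega) (by omega))
  have h4 : (((⌊g (M - 1)⌋ + 1 - ⌊g 0⌋).toNat : ℤ) : ℝ) = ⌊g (M - 1)⌋ + 1 - ⌊g 0⌋ := by
    rw [Int.toNat_of_nonneg (by omega)]; push_cast; ring
  rw [Int.cast_natCast] at h4
  rw [h4]
  have h5 := Int.floor_le (g (M - 1))
  have h6 := Int.lt_floor_add_one (g 0)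
  have h7 := hupp (M - 1) (by omega)
  have h8 : |hi| * ((M - 1 : ℕ) : ℝ) ≤ |hi| * ((M + 1 : ℕ) : ℝ) := by
    apply mul_le_mul_of_nonneg_left _ (abs_nonneg _)
    exact_mod_cast (by omega)
  linarith [mul_comm |hi| ((M + 1 : ℕ) : ℝ)]

/-! ### Regular phases and Weyl differencing -/

/-- The phase `f`, on `0 ≤ n < L`, has differences of orders `1, …, k` of constant sign, the `j`-th
one being of size `T / N ^ j` up to the constants `a` and `A`. The definition is stable under
`f ↦ f (· + r) - f`, with `T` replaced by `r * T / N` and `k` by `k - 1`. -/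
def HasRegularDiffs (a A N T : ℝ) (k L : ℕ) (f : ℕ → ℝ) : Prop :=
  ∀ j, 1 ≤ j → j ≤ k → ∃ s : ℝ, (s = 1 ∨ s = -1) ∧ ∀ n, n + j < L →
    a * (T / N ^ j) ≤ s * (fwdDiff 1)^[j] f n ∧ s * (fwdDiff 1)^[j] f n ≤ A * (T / N ^ j)

lemma HasRegularDiffs.mono {a A N T : ℝ} {k k' L : ℕ} {f : ℕ → ℝ}
    (h : HasRegularDiffs a A N T k L f) (hk : k' ≤ k) : HasRegularDiffs a A N T k' L f :=
  fun j h1 h2 => h j h1 (h2.trans hk)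

lemma HasRegularDiffs.neg {a A N T : ℝ} {k L : ℕ} {f : ℕ → ℝ}
    (h : HasRegularDiffs a A N T k L f) : HasRegularDiffs a A N T k L (fun n => -f n) := by
  intro j h1 h2
  obtain ⟨s, hs, h3⟩ := h j h1 h2
  refine ⟨-s, by rcases hs with rfl | rfl <;> simp, fun n hn => ?_⟩
  have : (fun n => -f n) = (-1 : ℝ) • f := by ext; simp
  rw [this, fwdDiff_iter_const_smul]
  simpa using h3 n hn

lemma fwdDiff_iter_shift_sub (f : ℕ → ℝ) (j r n : ℕ) :
    (fwdDiff 1)^[j] (fun n => f (n + r) - f n) n =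
      ∑ i ∈ range r, (fwdDiff 1)^[j + 1] f (n + i) := by
  have h : (fun n => f (n + r) - f n) = ∑ i ∈ range r, fun n => fwdDiff 1 f (n + i) := by
    ext m
    rw [Finset.sum_apply]
    have := Finset.sum_range_sub (fun i => f (m + i)) r
    simpa [fwdDiff, add_assoc] using this.symm
  rw [h, fwdDiff_iter_finsetSum, Finset.sum_apply]
  refine sum_congr rfl fun i _ => ?_
  rw [fwdDiff_iter_comp_add, Function.iterate_succ_apply]

lemma HasRegularDiffs.shift_sub {a A N T : ℝ} {k L r : ℕ} {f : ℕ → ℝ} (hN : 0 < N)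
    (h : HasRegularDiffs a A N T (k + 1) L f) :
    HasRegularDiffs a A N (r * T / N) k (L - r) (fun n => f (n + r) - f n) := by
  intro j h1 h2
  obtain ⟨s, hs, h3⟩ := h (j + 1) (by omega) (by omega)
  refine ⟨s, hs, fun n hn => ?_⟩
  rw [fwdDiff_iter_shift_sub, mul_sum]
  have e : ∀ b : ℝ, b * (r * T / N / N ^ j) = ∑ i ∈ range r, b * (T / N ^ (j + 1)) := by
    intro b
    rw [sum_const, card_range, nsmul_eq_mul, pow_succ]
    field_simp
  rw [e a, e A]
  constructor
  · refine sum_le_sum fun i hi => (h3 (n + i) ?_).1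
    rw [mem_range] at hi; omega
  · refine sum_le_sum fun i hi => (h3 (n + i) ?_).2
    rw [mem_range] at hi; omega

/-- The bound `√T + √N` for a regular phase whose second difference is positive. -/
lemma second_difference_regular_aux {a A N T : ℝ} (ha : 0 < a) (haA : a ≤ A) (hN : 1 ≤ N)
    (hT : Real.sqrt N ≤ T) {L : ℕ} (hL : (L : ℝ) ≤ N) {f : ℕ → ℝ}
    (h1 : ∃ s : ℝ, (s = 1 ∨ s = -1) ∧ ∀ n, n + 1 < L →
      a * (T / N) ≤ s * (f (n + 1) - f n) ∧ s * (f (n + 1) - f n) ≤ A * (T / N))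
    (h2 : ∀ n, n + 2 < L → a * (T / N ^ 2) ≤ (f (n + 2) - f (n + 1)) - (f (n + 1) - f n) ∧
      (f (n + 2) - f (n + 1)) - (f (n + 1) - f n) ≤ A * (T / N ^ 2)) :
    ‖∑ n ∈ range L, unitExp (f n)‖ ≤
      ((A + 2 * (2 * A + 1)) * (3 + 2 / a) + 1 / a + 2) * (Real.sqrt T + Real.sqrt N) := by
  have hA : 0 < A := ha.trans_le haA
  have hN0 : 0 < N := by linarith
  have hsN : 1 ≤ Real.sqrt N := Real.one_le_sqrt.2 hN
  have hT1 : 1 ≤ T := hsN.trans hT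
  have hsT : 1 ≤ Real.sqrt T := Real.one_le_sqrt.2 hT1
  have hNN := Real.mul_self_sqrt hN0.le
  have hTT := Real.mul_self_sqrt (by linarith : 0 ≤ T)
  have hcard := norm_sum_unitExp_le f (range L)
  rw [card_range] at hcard
  set X := Real.sqrt N
  set Y := Real.sqrt T
  have hcoef : 0 ≤ (A + 2 * (2 * A + 1)) * (3 + 2 / a) := by positivity
  have hia : 0 < 1 / a := by positivity
  rcases le_or_gt (A * (T / N)) (1 / 2) with hsmall | hlarge
  · -- the first differences stay inside an interval of length `1/2` ending at an integer
    have hb : ‖∑ n ∈ range L, unitExp (f n)‖ ≤ 1 / (a * (T / N)) + 1 := by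
      have hD : 0 < a * (T / N) := by positivity
      rcases Nat.eq_zero_or_pos L with rfl | hL0
      · simp; positivity
      obtain ⟨M, rfl⟩ : ∃ M, L = M + 1 := ⟨L - 1, by omega⟩
      rw [sum_range_succ]
      refine (norm_add_le _ _).trans (add_le_add ?_ (norm_unitExp _).le)
      have haT : a * (T / N) ≤ A * (T / N) := by gcongr
      rw [range_eq_Ico]
      obtain ⟨s, rfl | rfl, h1⟩ := h1
      · apply kusmin_landau f hD 0
        · intro n _ hn
          have := (h2 n (by omega)).1
          have h3 : 0 < a * (T / N ^ 2) := by positivity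
          linarith
        · intro n _ hn
          have := (h1 n (by omega)).1
          push_cast; linarith
        · intro n _ hn
          have := (h1 n (by omega)).2
          push_cast; linarith
      · apply kusmin_landau f hD (-1)
        · intro n _ hn
          have := (h2 n (by omega)).1
          have h3 : 0 < a * (T / N ^ 2) := by positivity
          linarith
        · intro n _ hn
          have := (h1 n (by omega)).2
          push_cast; linarith
        · intro n _ hn
          have := (h1 n (by omega)).1
          push_cast; linarith
    have h3 : 1 / (a * (T / N)) ≤ 1 / a * X := by
      have : 1 / (a * (T / N)) = 1 / a * (N / T) := by field_simp
      rw [this]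
      refine mul_le_mul_of_nonneg_left ?_ hia.le
      rw [div_le_iff₀ (by linarith)]
      nlinarith
    nlinarith
  · rcases le_or_gt (N ^ 2) T with hbig | hT2
    · -- the trivial bound `L ≤ N ≤ √T`
      have : N ≤ Y := Real.le_sqrt_of_sq_le hbig
      nlinarith
    · set D := Y / N with hDdef
      have hD : 0 < D := by positivity
      have hDD : D ^ 2 = T / N ^ 2 := by rw [hDdef, div_pow, sq Y, hTT]
      have hYN : Y ≤ N := by
        rw [Real.sqrt_le_left (by linarith)]; exact hT2.le
      have hD1 : 1 ≤ 1 / D := by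
        rw [hDdef, one_div_div, le_div_iff₀ (by linarith)]; linarith
      have h3 := second_difference_test f L (lo := a * (T / N ^ 2)) (hi := A * (T / N ^ 2))
        (by positivity) hD (fun n hn => (h2 n hn).1) (fun n hn => (h2 n hn).2)
      rw [abs_of_pos (by positivity), ← hDD] at h3
      have e1 : 1 / D + 2 * (D / (a * D ^ 2) + 1) ≤ (3 + 2 / a) * (1 / D) := by
        have : D / (a * D ^ 2) = 1 / a * (1 / D) := by field_simp
        rw [this]
        have : 2 / a = 2 * (1 / a) := by ring
        rw [this]
        nlinarith
      have e2 : (L : ℝ) * (A * D ^ 2) + 2 ≤ N * (A * D ^ 2) + 2 := by gcongr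
      -- `T ≥ N / (2A)` bounds `1 / D = N / √T`
      have e3 : 1 / D ≤ (2 * A + 1) * X := by
        rw [hDdef, one_div_div, div_le_iff₀ (by linarith)]
        have h4 : N < 2 * A * T := by
          rw [← mul_div_assoc, lt_div_iff₀ hN0] at hlarge; linarith
        have h5 : X ≤ (2 * A + 1) * Y := by
          apply Real.sqrt_le_iff.2
          refine ⟨by positivity, ?_⟩
          have : ((2 * A + 1) * Y) ^ 2 = (2 * A + 1) ^ 2 * T := by rw [mul_pow, sq Y, hTT]
          rw [this]
          nlinarith
        calc N = X * X := hNN.symm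
          _ ≤ X * ((2 * A + 1) * Y) := by gcongr
          _ = _ := by ring
      have e4 : N * (A * D ^ 2) * (1 / D) = A * Y := by
        rw [hDdef]; field_simp
      calc _ ≤ _ := h3
        _ ≤ (N * (A * D ^ 2) + 2) * ((3 + 2 / a) * (1 / D)) + 1 := by gcongr
        _ = (N * (A * D ^ 2) * (1 / D) + 2 * (1 / D)) * (3 + 2 / a) + 1 := by ring
        _ = (A * Y + 2 * (1 / D)) * (3 + 2 / a) + 1 := by rw [e4]
        _ ≤ (A * Y + 2 * ((2 * A + 1) * X)) * (3 + 2 / a) + 1 := by gcongr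
        _ ≤ _ := by
          have h6 : 0 ≤ (3 + 2 / a) := by positivity
          have h7 : A * Y + 2 * ((2 * A + 1) * X) ≤ (A + 2 * (2 * A + 1)) * (Y + X) := by
            nlinarith
          nlinarith

/-- The case of two differences: `√T + √N` bounds the sum, through Kusmin–Landau if `T` is small
compared to `N` and through the second derivative test otherwise. -/
lemma exists_bound_regular_two {a A : ℝ} (ha : 0 < a) (haA : a ≤ A) :
    ∃ C : ℝ, 0 < C ∧ ∀ (N T : ℝ) (L : ℕ) (f : ℕ → ℝ), 1 ≤ N → Real.sqrt N ≤ T → (L : ℝ) ≤ N →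
      HasRegularDiffs a A N T 2 L f →
      ‖∑ n ∈ range L, unitExp (f n)‖ ≤ C * (Real.sqrt T + Real.sqrt N) := by
  have hA : 0 < A := ha.trans_le haA
  refine ⟨(A + 2 * (2 * A + 1)) * (3 + 2 / a) + 1 / a + 2, by positivity,
    fun N T L f hN hT hL h => ?_⟩
  have key : ∀ g : ℕ → ℝ, HasRegularDiffs a A N T 2 L g → (∀ n, n + 2 < L →
      a * (T / N ^ 2) ≤ (g (n + 2) - g (n + 1)) - (g (n + 1) - g n) ∧
      (g (n + 2) - g (n + 1)) - (g (n + 1) - g n) ≤ A * (T / N ^ 2)) →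
      ‖∑ n ∈ range L, unitExp (g n)‖ ≤
      ((A + 2 * (2 * A + 1)) * (3 + 2 / a) + 1 / a + 2) * (Real.sqrt T + Real.sqrt N) := by
    intro g hg h2
    refine second_difference_regular_aux ha haA hN hT hL ?_ h2
    obtain ⟨s, hs, h3⟩ := hg 1 le_rfl (by norm_num)
    exact ⟨s, hs, fun n hn => by simpa [fwdDiff] using h3 n hn⟩
  obtain ⟨s, rfl | rfl, h3⟩ := h 2 (by norm_num) le_rfl
  · exact key f h fun n hn => by simpa [fwdDiff, add_assoc] using h3 n hn
  · rw [← norm_sum_unitExp_neg]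
    refine key _ h.neg fun n hn => ?_
    have := h3 n hn
    simp only [Function.iterate_succ, Function.iterate_zero, Function.comp, fwdDiff, id,
      add_assoc, Nat.reduceAdd] at this
    constructor <;> linarith

/-- Van der Corput's inequality (Weyl differencing). -/
lemma van_der_corput_inequality (f : ℕ → ℝ) (L Q : ℕ) (hQ : 1 ≤ Q) :
    ‖∑ n ∈ range L, unitExp (f n)‖ ^ 2 ≤ 2 * (L + Q) / Q *
      (L + ∑ r ∈ Ico 1 Q, ‖∑ n ∈ range (L - r), unitExp (f (n + r) - f n)‖) := by
  set S := ∑ n ∈ range L, unitExp (f n) with hS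
  -- the terms, moved to start at `Q` and extended by zero
  set u : ℕ → ℂ := fun m => if Q ≤ m ∧ m < Q + L then unitExp (f (m - Q)) else 0 with hu
  set R : ℕ → ℝ := fun r => ‖∑ n ∈ range (L - r), unitExp (f (n + r) - f n)‖ with hR
  have hshift : ∀ q, q ≤ Q → ∑ m ∈ range (L + Q), u (m + q) = S := by
    intro q hq
    have h1 : ∑ m ∈ range (L + Q), u (m + q) = ∑ m ∈ Ico (Q - q) (Q - q + L), u (m + q) := by
      symm
      apply sum_subset
      · intro m; simp only [mem_Ico, mem_range]; omega
      · intro m _ hm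
        simp only [mem_Ico] at hm
        simp only [hu]
        rw [if_neg (by omega)]
    rw [h1, sum_Ico_eq_sum_range, add_tsub_cancel_left]
    refine sum_congr rfl fun n hn => ?_
    rw [mem_range] at hn
    simp only [hu]
    rw [if_pos (by omega)]
    congr 2
    omega
  -- the correlation of two shifts depends only on their distance
  have hcorr : ∀ q r, q + r < Q →
      ‖∑ m ∈ range (L + Q), u (m + (q + r)) * (starRingEnd ℂ) (u (m + q))‖ = R r := by
    intro q r hqr
    have h1 : ∑ m ∈ range (L + Q), u (m + (q + r)) * (starRingEnd ℂ) (u (m + q)) =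
        ∑ m ∈ Ico (Q - q) (Q - q + (L - r)), u (m + (q + r)) * (starRingEnd ℂ) (u (m + q)) := by
      symm
      apply sum_subset
      · intro m; simp only [mem_Ico, mem_range]; omega
      · intro m _ hm
        simp only [mem_Ico] at hm
        simp only [hu]
        by_cases h : Q ≤ m + q
        · rw [if_neg (c := Q ≤ m + (q + r) ∧ _) (by omega), zero_mul]
        · rw [if_neg (c := Q ≤ m + q ∧ _) (by omega), map_zero, mul_zero]
    rw [h1, sum_Ico_eq_sum_range, add_tsub_cancel_left]
    simp only [hR]
    congr 1
    refine sum_congr rfl fun n hn => ?_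
    rw [mem_range] at hn
    simp only [hu]
    rw [if_pos (by omega), if_pos (by omega), conj_unitExp, ← unitExp_add, ← sub_eq_add_neg]
    congr 3 <;> omega
  have hcorr' : ∀ q q', q < Q → q' < Q →
      ‖∑ m ∈ range (L + Q), u (m + q) * (starRingEnd ℂ) (u (m + q'))‖ ≤
        R ((q - q') + (q' - q)) := by
    intro q q' hq hq'
    rcases le_total q q' with h | h
    · have := hcorr q (q' - q) (by omega)
      rw [← Complex.norm_conj, map_sum] at this
      rw [show q - q' + (q' - q) = q' - q by omega, ← this,
        show q + (q' - q) = q' by omega]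
      apply le_of_eq
      congr 1
      refine sum_congr rfl fun m _ => ?_
      rw [map_mul, Complex.conj_conj, mul_comm]
    · have := hcorr q' (q - q') (by omega)
      rw [show q - q' + (q' - q) = q - q' by omega, ← this,
        show q' + (q - q') = q by omega]
  have h1 : (Q : ℂ) * S = ∑ m ∈ range (L + Q), ∑ q ∈ range Q, u (m + q) := by
    rw [sum_comm, sum_congr rfl fun q hq => hshift q (mem_range.1 hq).le]
    simp
  have h2 : ((Q : ℝ) * ‖S‖) ^ 2 ≤
      (L + Q) * ∑ m ∈ range (L + Q), ‖∑ q ∈ range Q, u (m + q)‖ ^ 2 := by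
    have h3 : (Q : ℝ) * ‖S‖ ≤ ∑ m ∈ range (L + Q), ‖∑ q ∈ range Q, u (m + q)‖ := by
      have : (Q : ℝ) * ‖S‖ = ‖(Q : ℂ) * S‖ := by simp
      rw [this, h1]
      exact norm_sum_le _ _
    have h4 := sq_sum_le_card_mul_sum_sq (s := range (L + Q))
      (f := fun m => ‖∑ q ∈ range Q, u (m + q)‖)
    rw [card_range] at h4
    push_cast at h4
    exact (pow_le_pow_left₀ (by positivity) h3 2).trans h4
  have h3 : ∑ m ∈ range (L + Q), ‖∑ q ∈ range Q, u (m + q)‖ ^ 2 ≤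
      ∑ q ∈ range Q, ∑ q' ∈ range Q, R ((q - q') + (q' - q)) := by
    have e : ((∑ m ∈ range (L + Q), ‖∑ q ∈ range Q, u (m + q)‖ ^ 2 : ℝ) : ℂ) =
        ∑ q ∈ range Q, ∑ q' ∈ range Q,
          ∑ m ∈ range (L + Q), u (m + q) * (starRingEnd ℂ) (u (m + q')) := by
      rw [Complex.ofReal_sum]
      have : ∀ m, ((‖∑ q ∈ range Q, u (m + q)‖ ^ 2 : ℝ) : ℂ) =
          ∑ q ∈ range Q, ∑ q' ∈ range Q, u (m + q) * (starRingEnd ℂ) (u (m + q')) := by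
        intro m
        rw [← Complex.normSq_eq_norm_sq, ← Complex.mul_conj, map_sum, sum_mul_sum]
      rw [sum_congr rfl fun m _ => this m, sum_comm]
      refine sum_congr rfl fun q _ => ?_
      rw [sum_comm]
    have h5 : ∑ m ∈ range (L + Q), ‖∑ q ∈ range Q, u (m + q)‖ ^ 2 =
        ‖((∑ m ∈ range (L + Q), ‖∑ q ∈ range Q, u (m + q)‖ ^ 2 : ℝ) : ℂ)‖ := by
      rw [Complex.norm_real, Real.norm_of_nonneg (by positivity)]
    rw [h5, e]
    refine (norm_sum_le _ _).trans (sum_le_sum fun q hq => ?_)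
    refine (norm_sum_le _ _).trans (sum_le_sum fun q' hq' => ?_)
    exact hcorr' q q' (mem_range.1 hq) (mem_range.1 hq')
  have hR0 : ∀ r, 0 ≤ R r := fun r => norm_nonneg _
  have h4 : ∀ q ∈ range Q, ∑ q' ∈ range Q, R ((q - q') + (q' - q)) ≤ 2 * ∑ r ∈ range Q, R r := by
    intro q hq
    rw [mem_range] at hq
    have hle : ∀ q' ∈ range Q, R ((q - q') + (q' - q)) ≤
        (if q' ≤ q then R (q - q') else 0) + (if q ≤ q' then R (q' - q) else 0) := by
      intro q' _
      rcases le_total q' q with h | h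
      · rw [if_pos h, Nat.sub_eq_zero_of_le h, add_zero]
        split_ifs
        · linarith [hR0 (q' - q), hR0 0]
        · simp
      · rw [if_pos h, Nat.sub_eq_zero_of_le h, zero_add]
        split_ifs
        · linarith [hR0 (q - q'), hR0 0]
        · simp
    refine (sum_le_sum hle).trans ?_
    rw [sum_add_distrib, ← sum_filter, ← sum_filter, two_mul]
    refine add_le_add ?_ ?_
    · rw [← sum_image (f := R) (g := fun q' => q - q')]
      · apply sum_le_sum_of_subset_of_nonneg
        · intro r; simp only [mem_image, mem_filter, mem_range]
          rintro ⟨x, hx, rfl⟩; omega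
        · exact fun r _ _ => hR0 r
      · intro x hx y hy hxy
        simp only [coe_filter, mem_range, Set.mem_ofPred_eq] at hx hy
        simp only at hxy
        omega
    · rw [← sum_image (f := R) (g := fun q' => q' - q)]
      · apply sum_le_sum_of_subset_of_nonneg
        · intro r; simp only [mem_image, mem_filter, mem_range]
          rintro ⟨x, hx, rfl⟩; omega
        · exact fun r _ _ => hR0 r
      · intro x hx y hy hxy
        simp only [coe_filter, mem_range, Set.mem_ofPred_eq] at hx hy
        simp only at hxy
        omega
  have h5 : ∑ q ∈ range Q, ∑ q' ∈ range Q, R ((q - q') + (q' - q)) ≤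
      Q * (2 * ∑ r ∈ range Q, R r) := by
    refine (sum_le_sum h4).trans ?_
    rw [sum_const, card_range, nsmul_eq_mul]
  have h6 : ∑ r ∈ range Q, R r = L + ∑ r ∈ Ico 1 Q, R r := by
    rw [range_eq_Ico, sum_eq_sum_Ico_succ_bot (by omega)]
    congr 1
    simp [hR, unitExp]
  have hQ0 : (0 : ℝ) < Q := by exact_mod_cast hQ
  have h7 : ((Q : ℝ) * ‖S‖) ^ 2 ≤ (L + Q) * (Q * (2 * (L + ∑ r ∈ Ico 1 Q, R r))) := by
    rw [← h6]
    exact h2.trans (mul_le_mul_of_nonneg_left (h3.trans h5) (by positivity))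
  have h8 : 2 * ((L : ℝ) + Q) / Q * (L + ∑ r ∈ Ico 1 Q, R r) =
      (L + Q) * (Q * (2 * (L + ∑ r ∈ Ico 1 Q, R r))) / Q ^ 2 := by
    field_simp
  rw [h8, le_div_iff₀ (by positivity)]
  linarith

/-! ### The `k`-th derivative test -/

/-- The differencing length: both terms of van der Corput's inequality are controlled by
`q ^ (1 / (2K - 1)) + N ^ (-1 / K)`. -/
lemma exists_differencing_length {q N K : ℝ} (hq : 0 < q) (hq1 : q ≤ 1) (hN : 1 ≤ N)
    (hK : 2 ≤ K) : ∃ Q : ℕ, 1 ≤ Q ∧ (Q : ℝ) ≤ N ∧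
      1 / (Q : ℝ) ≤ 2 * (q ^ (1 / (2 * K - 1)) + N ^ (-1 / K)) ∧
      (Q * q) ^ (1 / (2 * K - 2)) ≤ q ^ (1 / (2 * K - 1)) := by
  have hN0 : 0 < N := by linarith
  set u := q ^ (-(1 / (2 * K - 1))) with hu
  set v := N ^ (1 / K) with hv
  have hu1 : 1 ≤ u := Real.one_le_rpow_of_pos_of_le_one_of_nonpos hq hq1
    (by have : 0 < 2 * K - 1 := by linarith
        have : 0 < 1 / (2 * K - 1) := by positivity
        linarith)
  have hv1 : 1 ≤ v := Real.one_le_rpow hN (by positivity)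
  have hmin : 1 ≤ min u v := le_min hu1 hv1
  have hfl : (⌊min u v⌋₊ : ℝ) ≤ min u v := Nat.floor_le (by linarith)
  have hfl2 : min u v < (⌊min u v⌋₊ : ℝ) + 1 := Nat.lt_floor_add_one _
  have hfl1 : 1 ≤ ⌊min u v⌋₊ := Nat.le_floor (by exact_mod_cast hmin)
  have hfl1' : (1 : ℝ) ≤ ⌊min u v⌋₊ := by exact_mod_cast hfl1
  have hu' : q ^ (1 / (2 * K - 1)) = 1 / u := by
    rw [hu, Real.rpow_neg hq.le, one_div (_ ⁻¹), inv_inv]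
  have hv' : N ^ (-1 / K) = 1 / v := by
    rw [hv, neg_div, Real.rpow_neg hN0.le, one_div, one_div]
  refine ⟨⌊min u v⌋₊, hfl1, ?_, ?_, ?_⟩
  · calc (⌊min u v⌋₊ : ℝ) ≤ v := hfl.trans (min_le_right _ _)
      _ ≤ N ^ (1 : ℝ) := Real.rpow_le_rpow_of_exponent_le hN (by
          rw [div_le_one (by linarith)]; linarith)
      _ = N := Real.rpow_one N
  · rw [hu', hv']
    have h1 : 1 / (⌊min u v⌋₊ : ℝ) ≤ 2 / min u v := by
      rw [div_le_div_iff₀ (by linarith) (by linarith)]; linarith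
    have h2 : 1 / min u v ≤ 1 / u + 1 / v := by
      have : 0 < 1 / u := by positivity
      have : 0 < 1 / v := by positivity
      rcases min_choice u v with h | h <;> rw [h] <;> linarith
    calc _ ≤ _ := h1
      _ = 2 * (1 / min u v) := by ring
      _ ≤ _ := by gcongr
  · have h1 : (⌊min u v⌋₊ : ℝ) * q ≤ q ^ ((2 * K - 2) / (2 * K - 1)) := by
      calc (⌊min u v⌋₊ : ℝ) * q ≤ u * q := by
            gcongr; exact hfl.trans (min_le_left _ _)
        _ = u * q ^ (1 : ℝ) := by rw [Real.rpow_one]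
        _ = _ := by
          rw [hu, ← Real.rpow_add hq]; congr 1
          have : 2 * K - 1 ≠ 0 := by linarith
          field_simp; ring
    have hk : 0 < 2 * K - 2 := by linarith
    calc _ ≤ (q ^ ((2 * K - 2) / (2 * K - 1))) ^ (1 / (2 * K - 2)) :=
          Real.rpow_le_rpow (by positivity) h1 (by positivity)
      _ = _ := by
        rw [← Real.rpow_mul hq.le]; congr 1
        have : 2 * K - 1 ≠ 0 := by linarith
        rw [div_mul_div_comm, mul_one, div_mul_cancel_right₀ hk.ne', one_div]

lemma sqrt_add_le_add_sqrt {x y : ℝ} (hx : 0 ≤ x) (hy : 0 ≤ y) :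
    Real.sqrt (x + y) ≤ Real.sqrt x + Real.sqrt y := by
  rw [Real.sqrt_le_left (by positivity)]
  have h1 := Real.sq_sqrt hx
  have h2 := Real.sq_sqrt hy
  have : 0 ≤ Real.sqrt x * Real.sqrt y := by positivity
  nlinarith

/-- The `k`-th derivative test, `k = r + 2`, for phases all of whose differences up to order `k` are
regular. Regularity of the low orders takes the place of the usual lower bound on the `k`-th
difference, and keeps the second term independent of `T`. -/
theorem exists_bound_regular {a A : ℝ} (ha : 0 < a) (haA : a ≤ A) (r : ℕ) :
    ∃ C : ℝ, 0 < C ∧ ∀ (N T : ℝ) (L : ℕ) (f : ℕ → ℝ), 1 ≤ N → Real.sqrt N ≤ T → (L : ℝ) ≤ N →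
      HasRegularDiffs a A N T (r + 2) L f →
      ‖∑ n ∈ range L, unitExp (f n)‖ ≤
        C * (N * ((T / N ^ (r + 2)) ^ (1 / (2 * (2 : ℝ) ^ (r + 1) - 2)) +
          N ^ (-1 / (2 : ℝ) ^ (r + 1)))) := by
  obtain ⟨C₂, hC₂, hbase⟩ := exists_bound_regular_two ha haA
  induction r with
  | zero =>
    refine ⟨C₂, hC₂, fun N T L f hN hT hL h => ?_⟩
    have hN0 : 0 < N := by linarith
    convert hbase N T L f hN hT hL h using 2
    rw [mul_add]
    congr 1
    · norm_num
      rw [← Real.sqrt_eq_rpow, Real.sqrt_div' _ (by positivity), Real.sqrt_sq hN0.le]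
      field_simp
    · rw [Real.sqrt_eq_rpow]
      nth_rewrite 1 [← Real.rpow_one N]
      rw [← Real.rpow_add hN0]; norm_num
  | succ r ih =>
    obtain ⟨C, hC, ih⟩ := ih
    refine ⟨2 * C₂ + Real.sqrt (8 + 4 * C) + 1, by positivity, fun N T L f hN hT hL h => ?_⟩
    have hN0 : 0 < N := by linarith
    have hT0 : 0 < T := (Real.sqrt_pos.2 hN0).trans_le hT
    set K : ℝ := (2 : ℝ) ^ (r + 1) with hK
    have hK2 : 2 ≤ K := by
      rw [hK, pow_succ]
      have : (1 : ℝ) ≤ 2 ^ r := one_le_pow₀ (by norm_num)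
      linarith
    have hK' : (2 : ℝ) ^ (r + 1 + 1) = 2 * K := by rw [pow_succ, mul_comm]
    rw [hK']
    set q := T / N ^ (r + 1 + 2) with hqdef
    have hq : 0 < q := by positivity
    set U := q ^ (1 / (2 * (2 * K) - 2)) with hU
    set V := N ^ (-1 / (2 * K)) with hV
    have hU0 : 0 < U := Real.rpow_pos_of_pos hq _
    have hV0 : 0 < V := Real.rpow_pos_of_pos hN0 _
    have hs0 : 0 ≤ Real.sqrt (8 + 4 * C) := Real.sqrt_nonneg _
    rcases lt_or_ge T (N * Real.sqrt N) with hTs | hTl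
    · -- here the two-difference bound already gives `N ^ (3 / 4)`
      have h1 := hbase N T L f hN hT hL (h.mono (by omega))
      have hexp : N ^ (3 / 4 : ℝ) ≤ N * V := by
        nth_rewrite 2 [← Real.rpow_one N]
        rw [hV, ← Real.rpow_add hN0]
        apply Real.rpow_le_rpow_of_exponent_le hN
        have : 1 / (2 * K) ≤ 1 / 4 := one_div_le_one_div_of_le (by norm_num) (by linarith)
        rw [neg_div]; linarith
      have h2 : Real.sqrt T ≤ N ^ (3 / 4 : ℝ) := by
        have : N ^ (3 / 4 : ℝ) = Real.sqrt (N * Real.sqrt N) := by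
          rw [Real.sqrt_eq_rpow, Real.sqrt_eq_rpow]
          nth_rewrite 2 [← Real.rpow_one N]
          rw [← Real.rpow_add hN0, ← Real.rpow_mul hN0.le]; norm_num
        rw [this]
        exact Real.sqrt_le_sqrt hTs.le
      have h3 : Real.sqrt N ≤ N ^ (3 / 4 : ℝ) := by
        rw [Real.sqrt_eq_rpow]
        exact Real.rpow_le_rpow_of_exponent_le hN (by norm_num)
      calc _ ≤ _ := h1
        _ ≤ C₂ * (N * V + N * V) := by gcongr <;> linarith
        _ = 2 * C₂ * (N * V) := by ring
        _ ≤ _ := by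
          apply mul_le_mul _ _ (by positivity) (by positivity)
          · linarith
          · gcongr; linarith
    · rcases le_or_gt q 1 with hq1 | hq1
      · obtain ⟨Q, hQ1, hQN, hQi, hQq⟩ := exists_differencing_length hq hq1 hN hK2
        set B := q ^ (1 / (2 * K - 1)) + N ^ (-1 / K) with hB
        have hB0 : 0 < B := by
          have := Real.rpow_pos_of_pos hq (1 / (2 * K - 1))
          have := Real.rpow_pos_of_pos hN0 (-1 / K)
          positivity
        have hQ0 : (0 : ℝ) < Q := by exact_mod_cast hQ1
        have hvdc := van_der_corput_inequality f L Q hQ1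
        have hcor : ∀ m ∈ Ico 1 Q,
            ‖∑ n ∈ range (L - m), unitExp (f (n + m) - f n)‖ ≤ C * (N * B) := by
          intro m hm
          rw [mem_Ico] at hm
          have hm1 : (1 : ℝ) ≤ m := by exact_mod_cast hm.1
          have hmQ : (m : ℝ) ≤ Q := by exact_mod_cast hm.2.le
          have h1 := ih N (m * T / N) (L - m) (fun n => f (n + m) - f n) hN (by
            rw [le_div_iff₀ hN0]
            nlinarith [Real.sqrt_nonneg N]) (by
            refine le_trans ?_ hL
            exact_mod_cast Nat.sub_le _ _) (HasRegularDiffs.shift_sub hN0 h)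
          refine h1.trans ?_
          have h2 : m * T / N / N ^ (r + 2) = m * q := by
            rw [hqdef, pow_succ N (r + 2)]
            field_simp
          rw [h2]
          have h3 : ((m : ℝ) * q) ^ (1 / (2 * K - 2)) ≤ q ^ (1 / (2 * K - 1)) := by
            refine le_trans ?_ hQq
            have : 0 < 2 * K - 2 := by linarith
            apply Real.rpow_le_rpow (by positivity) (by gcongr) (by positivity)
          rw [hB]
          gcongr
        have hsum : ∑ m ∈ Ico 1 Q, ‖∑ n ∈ range (L - m), unitExp (f (n + m) - f n)‖ ≤
            Q * (C * (N * B)) := by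
          refine (sum_le_sum hcor).trans ?_
          rw [sum_const, nsmul_eq_mul, Nat.card_Ico]
          have : ((Q - 1 : ℕ) : ℝ) ≤ Q := by exact_mod_cast Nat.sub_le _ _
          gcongr
        have hsq : ‖∑ n ∈ range L, unitExp (f n)‖ ^ 2 ≤ (8 + 4 * C) * (N ^ 2 * B) := by
          calc _ ≤ _ := hvdc
            _ ≤ 2 * (N + N) / Q * (N + Q * (C * (N * B))) := by gcongr
            _ = 4 * N ^ 2 * (1 / Q) + 4 * C * (N ^ 2 * B) := by field_simp; ring
            _ ≤ 4 * N ^ 2 * (2 * B) + 4 * C * (N ^ 2 * B) := by gcongr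
            _ = _ := by ring
        have hBs : Real.sqrt B ≤ U + V := by
          refine (sqrt_add_le_add_sqrt (Real.rpow_nonneg hq.le _)
            (Real.rpow_nonneg hN0.le _)).trans (le_of_eq ?_)
          rw [Real.sqrt_eq_rpow, Real.sqrt_eq_rpow, ← Real.rpow_mul hq.le, ← Real.rpow_mul hN0.le,
            hU, hV]
          have : 2 * K - 1 ≠ 0 := by linarith
          have : 2 * (2 * K) - 2 ≠ 0 := by linarith
          congr 2
          · field_simp
          · field_simp
        calc ‖∑ n ∈ range L, unitExp (f n)‖ ≤ Real.sqrt ((8 + 4 * C) * (N ^ 2 * B)) :=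
              Real.le_sqrt_of_sq_le hsq
          _ = Real.sqrt (8 + 4 * C) * (N * Real.sqrt B) := by
            rw [Real.sqrt_mul (by positivity), Real.sqrt_mul (by positivity), Real.sqrt_sq hN0.le]
          _ ≤ Real.sqrt (8 + 4 * C) * (N * (U + V)) := by gcongr
          _ ≤ _ := by gcongr; linarith
      · -- `T > N ^ k`: the trivial bound `L ≤ N`
        have hU1 : 1 ≤ U := Real.one_le_rpow hq1.le (by
          have : 0 < 2 * (2 * K) - 2 := by linarith
          positivity)
        have h1 := norm_sum_unitExp_le f (range L)
        rw [card_range] at h1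
        have h2 : N ≤ N * (U + V) := by nlinarith
        have h3 : 0 ≤ N * (U + V) := by positivity
        nlinarith

/-! ### From exponential sums to the sawtooth function -/

/-- The sawtooth function `{y} - 1/2`. -/
noncomputable def sawtooth (y : ℝ) : ℝ := Int.fract y - 1 / 2

/-- The periodic second Bernoulli function `{y}² - {y} + 1/6`, which integrates twice the
sawtooth. -/
noncomputable def periodicBernoulliTwo (y : ℝ) : ℝ := Int.fract y ^ 2 - Int.fract y + 1 / 6

/-- The forward difference quotient of `B₂({·})` is at most twice the sawtooth, up to `η`: there is
equality where no integer is crossed, and crossing one only lowers the left side. -/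
lemma periodicBernoulliTwo_sub_le (y : ℝ) {η : ℝ} (hη : 0 ≤ η) :
    periodicBernoulliTwo (y + η) - periodicBernoulliTwo y ≤ 2 * η * sawtooth y + η ^ 2 := by
  have h0 : Int.fract (y + η) = Int.fract y + η - ⌊Int.fract y + η⌋ := by
    rw [Int.self_sub_floor, ← Int.fract_add_intCast (Int.fract y + η) ⌊y⌋]
    congr 1
    have := Int.fract_add_floor y
    linarith
  have hx := Int.fract_nonneg y
  unfold periodicBernoulliTwo sawtooth
  rw [h0]
  set x := Int.fract y
  have h1 := Int.floor_le (x + η)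
  have h2 : 0 ≤ ⌊x + η⌋ := Int.floor_nonneg.2 (by linarith)
  rcases h2.eq_or_lt with h | h
  · rw [← h]; push_cast; nlinarith
  · have h3 : (1 : ℝ) ≤ ⌊x + η⌋ := by exact_mod_cast h
    nlinarith

lemma le_periodicBernoulliTwo_sub (y : ℝ) {η : ℝ} (hη : 0 ≤ η) :
    2 * η * sawtooth y ≤ periodicBernoulliTwo y - periodicBernoulliTwo (y + -η) + η ^ 2 := by
  have h0 : Int.fract (y + -η) = Int.fract y - η - ⌊Int.fract y - η⌋ := by
    rw [Int.self_sub_floor, ← Int.fract_add_intCast (Int.fract y - η) ⌊y⌋]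
    congr 1
    have := Int.fract_add_floor y
    linarith
  have hx := Int.fract_lt_one y
  unfold periodicBernoulliTwo sawtooth
  rw [h0]
  set x := Int.fract y
  have h1 := Int.lt_floor_add_one (x - η)
  have h2 : ⌊x - η⌋ < 1 := Int.floor_lt.2 (by push_cast; linarith)
  rcases (Int.lt_add_one_iff.1 h2 : ⌊x - η⌋ ≤ 0).eq_or_lt with h | h
  · rw [h]; push_cast; nlinarith
  · have h3 : (⌊x - η⌋ : ℝ) ≤ -1 := by exact_mod_cast Int.le_sub_one_of_lt h
    nlinarith

lemma hasSum_periodicBernoulliTwo (y : ℝ) :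
    HasSum (fun h : ℕ => 1 / (Real.pi ^ 2 * (h : ℝ) ^ 2) * (unitExp (h * y)).re)
      (periodicBernoulliTwo y) := by
  have h1 := hasSum_one_div_nat_pow_mul_cos one_ne_zero (x := Int.fract y)
    ⟨Int.fract_nonneg y, (Int.fract_lt_one y).le⟩
  have h2 := h1.mul_left (1 / Real.pi ^ 2)
  have hpi := Real.pi_pos
  have e1 : (fun h : ℕ => 1 / (Real.pi ^ 2 * (h : ℝ) ^ 2) * (unitExp (h * y)).re) =
      fun h : ℕ => 1 / Real.pi ^ 2 *
        (1 / (h : ℝ) ^ (2 * 1) * Real.cos (2 * Real.pi * h * Int.fract y)) := by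
    ext h
    have : Real.cos (2 * Real.pi * h * Int.fract y) = Real.cos (2 * Real.pi * (h * y)) := by
      rw [← Real.cos_sub_int_mul_two_pi (2 * Real.pi * (h * y)) (h * ⌊y⌋)]
      congr 1
      rw [← Int.self_sub_floor]; push_cast; ring
    rw [unitExp_re, this, mul_one]
    field_simp
  have e2 : periodicBernoulliTwo y = 1 / Real.pi ^ 2 *
      ((-1) ^ (1 + 1) * (2 * Real.pi) ^ (2 * 1) / 2 / (2 * 1).factorial *
        Polynomial.eval (Int.fract y)
          (Polynomial.map (algebraMap ℚ ℝ) (Polynomial.bernoulli (2 * 1)))) := by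
    simp [periodicBernoulliTwo, Polynomial.bernoulli, sum_range_succ, Polynomial.map_monomial,
      bernoulli_two, bernoulli_one]
    field_simp
    ring
  rw [e1, e2]
  exact h2

lemma norm_unitExp_sub_one_le (t : ℝ) : ‖unitExp t - 1‖ ≤ 2 * Real.pi * |t| := by
  have := Real.norm_exp_I_mul_ofReal_sub_one_le (x := 2 * Real.pi * t)
  rw [unitExp]
  convert this using 2
  · congr 1; push_cast; ring_nf
  · rw [Real.norm_eq_abs, abs_mul, abs_of_pos Real.two_pi_pos]

/-- Weights bounding the Fourier coefficients of the sawtooth smoothed at scale `1 / H`. -/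
noncomputable def sawtoothWeight (H h : ℕ) : ℝ := min (1 / (h : ℝ)) (H / (h : ℝ) ^ 2)

lemma sawtoothWeight_nonneg (H h : ℕ) : 0 ≤ sawtoothWeight H h := by
  unfold sawtoothWeight; positivity

lemma abs_sum_periodicBernoulliTwo_sub_le (f : ℕ → ℝ) (L : ℕ) {H : ℕ} (hH : 1 ≤ H) {G : ℕ → ℝ}
    (hG : ∀ h : ℕ, 1 ≤ h → ‖∑ n ∈ range L, unitExp (h * f n)‖ ≤ G h)
    (hs : Summable fun h => sawtoothWeight H h * G h) {η : ℝ} (hη : |η| = 1 / H) :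
    |∑ n ∈ range L, (periodicBernoulliTwo (f n + η) - periodicBernoulliTwo (f n))| ≤
      2 / H * ∑' h, sawtoothWeight H h * G h := by
  have hpi := Real.pi_gt_three
  have hH0 : (0 : ℝ) < H := by exact_mod_cast hH
  have h1 : HasSum (fun h : ℕ => ∑ n ∈ range L,
      (1 / (Real.pi ^ 2 * (h : ℝ) ^ 2) * (unitExp (h * (f n + η))).re -
        1 / (Real.pi ^ 2 * (h : ℝ) ^ 2) * (unitExp (h * f n)).re))
      (∑ n ∈ range L, (periodicBernoulliTwo (f n + η) - periodicBernoulliTwo (f n))) :=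
    hasSum_sum fun n _ => (hasSum_periodicBernoulliTwo _).sub (hasSum_periodicBernoulliTwo _)
  have h2 : ∀ h : ℕ, |∑ n ∈ range L,
      (1 / (Real.pi ^ 2 * (h : ℝ) ^ 2) * (unitExp (h * (f n + η))).re -
        1 / (Real.pi ^ 2 * (h : ℝ) ^ 2) * (unitExp (h * f n)).re)| ≤
      2 / H * (sawtoothWeight H h * G h) := by
    intro h
    rcases Nat.eq_zero_or_pos h with rfl | hpos
    · simp [sawtoothWeight]
    have hh : (0 : ℝ) < h := by exact_mod_cast hpos
    have e : ∑ n ∈ range L,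
      (1 / (Real.pi ^ 2 * (h : ℝ) ^ 2) * (unitExp (h * (f n + η))).re -
        1 / (Real.pi ^ 2 * (h : ℝ) ^ 2) * (unitExp (h * f n)).re) =
        1 / (Real.pi ^ 2 * (h : ℝ) ^ 2) *
          ((unitExp (h * η) - 1) * ∑ n ∈ range L, unitExp (h * f n)).re := by
      rw [mul_sum, Complex.re_sum, mul_sum]
      refine sum_congr rfl fun n _ => ?_
      rw [mul_add, unitExp_add, ← mul_sub, ← Complex.sub_re]
      congr 2; ring
    have hu1 : ‖unitExp (h * η) - 1‖ ≤ 2 := by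
      refine (norm_sub_le _ _).trans ?_
      rw [norm_unitExp]; norm_num
    have hu2 : ‖unitExp (h * η) - 1‖ ≤ 2 * Real.pi * (h / H) := by
      refine (norm_unitExp_sub_one_le _).trans (le_of_eq ?_)
      rw [abs_mul, hη, abs_of_pos hh]; ring
    have hw : 1 / (Real.pi ^ 2 * (h : ℝ) ^ 2) * ‖unitExp (h * η) - 1‖ ≤
        2 / H * sawtoothWeight H h := by
      unfold sawtoothWeight
      rw [mul_min_of_nonneg _ _ (by positivity)]
      apply le_min
      · calc _ ≤ 1 / (Real.pi ^ 2 * (h : ℝ) ^ 2) * (2 * Real.pi * (h / H)) := by gcongr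
          _ = 2 / H * (1 / h) * (1 / Real.pi) := by field_simp
          _ ≤ 2 / H * (1 / h) * 1 := by
            gcongr
            rw [div_le_one (by linarith)]; linarith
          _ = _ := mul_one _
      · calc _ ≤ 1 / (Real.pi ^ 2 * (h : ℝ) ^ 2) * 2 := by gcongr
          _ = 2 / (h : ℝ) ^ 2 * (1 / Real.pi ^ 2) := by field_simp
          _ ≤ 2 / (h : ℝ) ^ 2 * 1 := by
            gcongr
            rw [div_le_one (by positivity)]; nlinarith
          _ = _ := by field_simp
    rw [e, abs_mul, abs_of_pos (by positivity)]
    calc _ ≤ 1 / (Real.pi ^ 2 * (h : ℝ) ^ 2) *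
          (‖unitExp (h * η) - 1‖ * ‖∑ n ∈ range L, unitExp (h * f n)‖) := by
          gcongr
          rw [← norm_mul]
          exact Complex.abs_re_le_norm _
      _ ≤ 1 / (Real.pi ^ 2 * (h : ℝ) ^ 2) * (‖unitExp (h * η) - 1‖ * G h) := by
          gcongr; exact hG h hpos
      _ = (1 / (Real.pi ^ 2 * (h : ℝ) ^ 2) * ‖unitExp (h * η) - 1‖) * G h := by ring
      _ ≤ (2 / H * sawtoothWeight H h) * G h := by
          gcongr; exact (norm_nonneg _).trans (hG h hpos)
      _ = _ := by ring
  rw [← tsum_mul_left, ← h1.tsum_eq, ← Real.norm_eq_abs]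
  exact tsum_of_norm_bounded (hs.mul_left (2 / (H : ℝ))).hasSum h2

/-- An Erdős–Turán type inequality: sums of the sawtooth function are controlled by exponential
sums. The average of the sawtooth over an interval of length `1 / H` to either side, being a
difference quotient of `periodicBernoulliTwo`, has an absolutely convergent Fourier series. -/
lemma abs_sum_sawtooth_le (f : ℕ → ℝ) (L : ℕ) {H : ℕ} (hH : 1 ≤ H) {G : ℕ → ℝ}
    (hG : ∀ h : ℕ, 1 ≤ h → ‖∑ n ∈ range L, unitExp (h * f n)‖ ≤ G h)
    (hs : Summable fun h => sawtoothWeight H h * G h) :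
    |∑ n ∈ range L, sawtooth (f n)| ≤ L / H + ∑' h, sawtoothWeight H h * G h := by
  have hH0 : (0 : ℝ) < H := by exact_mod_cast hH
  have hη : (0 : ℝ) ≤ 1 / H := by positivity
  have h1 := abs_le.1 (abs_sum_periodicBernoulliTwo_sub_le f L hH hG hs (abs_of_nonneg hη))
  have h2 := abs_le.1 (abs_sum_periodicBernoulliTwo_sub_le f L hH hG hs (η := -(1 / H))
    (by rw [abs_neg, abs_of_nonneg hη]))
  set W := ∑' h, sawtoothWeight H h * G h
  have h3 : ∑ n ∈ range L, (periodicBernoulliTwo (f n + 1 / H) - periodicBernoulliTwo (f n)) ≤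
      2 * (1 / H) * ∑ n ∈ range L, sawtooth (f n) + L * (1 / H) ^ 2 := by
    refine (sum_le_sum fun n _ => periodicBernoulliTwo_sub_le (f n) hη).trans (le_of_eq ?_)
    rw [sum_add_distrib, ← mul_sum, sum_const, card_range, nsmul_eq_mul]
  have h4 : 2 * (1 / H) * ∑ n ∈ range L, sawtooth (f n) ≤
      -∑ n ∈ range L, (periodicBernoulliTwo (f n + -(1 / H)) - periodicBernoulliTwo (f n)) +
        L * (1 / H) ^ 2 := by
    rw [mul_sum]
    refine (sum_le_sum fun n _ => le_periodicBernoulliTwo_sub (f n) hη).trans (le_of_eq ?_)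
    rw [sum_add_distrib, ← sum_neg_distrib, sum_const, card_range, nsmul_eq_mul]
    congr 1
    exact sum_congr rfl fun n _ => by ring
  set Z := ∑ n ∈ range L, sawtooth (f n)
  have hL0 : (0 : ℝ) ≤ L := Nat.cast_nonneg L
  have e1 : 2 * (1 / (H : ℝ)) * Z = (2 / H) * Z := by ring
  have e2 : (L : ℝ) * (1 / H) ^ 2 = (2 / H) * (L / H / 2) := by field_simp
  rw [e1, e2] at h3 h4
  have h2H : (0 : ℝ) < 2 / H := by positivity
  have hLH : 0 ≤ (L : ℝ) / H := by positivity
  rw [abs_le]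
  constructor
  · have h5 : (2 / H) * (-(L / H / 2) - W) ≤ (2 / H) * Z := by linarith [h1.1]
    have := le_of_mul_le_mul_left h5 h2H
    linarith
  · have h5 : (2 / H) * Z ≤ (2 / H) * (L / H / 2 + W) := by linarith [h2.1]
    have := le_of_mul_le_mul_left h5 h2H
    linarith

lemma mul_rpow_le_rpow_sub {u : ℝ} (hu : 0 ≤ u) (hu1 : u ≤ 1) {x : ℝ} (hx : 1 ≤ x) :
    u * x ^ (u - 1) ≤ x ^ u - (x - 1) ^ u := by
  have hx0 : 0 < x := by linarith
  have h1 := rpow_one_add_le_one_add_mul_self (s := -1 / x)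
    (by rw [le_div_iff₀ hx0]; linarith) hu hu1
  have h2 : (x - 1) ^ u = x ^ u * (1 + -1 / x) ^ u := by
    rw [← Real.mul_rpow hx0.le]
    · congr 1; field_simp; ring
    · have : 1 / x ≤ 1 := by rw [div_le_one hx0]; exact hx
      rw [neg_div]; linarith
  have h3 : x ^ (u - 1) = x ^ u * (1 / x) := by
    rw [Real.rpow_sub_one hx0.ne']; ring
  have h4 : 0 < x ^ u := Real.rpow_pos_of_pos hx0 u
  rw [h2, h3]
  have h5 : u * (-1 / x) = -(u * (1 / x)) := by ring
  rw [h5] at h1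
  nlinarith

lemma mul_rpow_le_rpow_sub_neg {p : ℝ} (hp : 0 ≤ p) (hp1 : p ≤ 1) {x : ℝ} (hx : 1 < x) :
    p * x ^ (-p - 1) ≤ (x - 1) ^ (-p) - x ^ (-p) := by
  have hx0 : 0 < x := by linarith
  have h1 := mul_rpow_le_rpow_sub hp hp1 hx.le
  rw [Real.rpow_sub_one hx0.ne'] at h1 ⊢
  rw [Real.rpow_neg hx0.le, Real.rpow_neg (by linarith)]
  have ha : 0 < x ^ p := Real.rpow_pos_of_pos hx0 p
  have hb : 0 < (x - 1) ^ p := Real.rpow_pos_of_pos (by linarith) p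
  have hab : (x - 1) ^ p ≤ x ^ p := Real.rpow_le_rpow (by linarith) (by linarith) hp
  set a := x ^ p
  set b := (x - 1) ^ p
  have e : b⁻¹ - a⁻¹ = (a - b) / (a * b) := by field_simp
  rw [e, le_div_iff₀ (by positivity)]
  have : p * (a⁻¹ / x) * (a * b) = p * (b / x) := by field_simp
  rw [this]
  refine le_trans ?_ h1
  gcongr

/-- `∑ min (1/h, H/h²) h^u ≪ H^u` for `0 < u < 1`: the head and the tail are compared with
telescoping sums of `h^u` and `h^(u-1)`. -/
lemma summable_sawtoothWeight {u : ℝ} (hu : 0 < u) (hu1 : u < 1) {H : ℕ} (hH : 1 ≤ H) :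
    Summable (fun h : ℕ => sawtoothWeight H h * (h : ℝ) ^ u) ∧
      ∑' h : ℕ, sawtoothWeight H h * (h : ℝ) ^ u ≤ (1 / u + 1 / (1 - u)) * (H : ℝ) ^ u := by
  have hH0 : (0 : ℝ) < H := by exact_mod_cast hH
  have hu1' : 0 < 1 - u := by linarith
  have hnn : ∀ h : ℕ, 0 ≤ sawtoothWeight H h * (h : ℝ) ^ u := fun h =>
    mul_nonneg (sawtoothWeight_nonneg H h) (Real.rpow_nonneg (Nat.cast_nonneg h) _)
  have hHu : 0 ≤ (H : ℝ) ^ u := Real.rpow_nonneg hH0.le _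
  have hhead : ∀ M, M ≤ H →
      ∑ h ∈ range (M + 1), sawtoothWeight H h * (h : ℝ) ^ u ≤ 1 / u * (M : ℝ) ^ u := by
    intro M
    induction M with
    | zero => intro _; simp [sawtoothWeight, Real.zero_rpow hu.ne']
    | succ M ih =>
      intro hM
      rw [sum_range_succ]
      have h1 := ih (by omega)
      have hx : (1 : ℝ) ≤ ((M + 1 : ℕ) : ℝ) := by exact_mod_cast Nat.succ_pos M
      have h2 := mul_rpow_le_rpow_sub hu.le hu1.le hx
      have h3 : (((M + 1 : ℕ) : ℝ) - 1) = M := by push_cast; ring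
      rw [h3] at h2
      have h4 : sawtoothWeight H (M + 1) * ((M + 1 : ℕ) : ℝ) ^ u ≤
          ((M + 1 : ℕ) : ℝ) ^ (u - 1) := by
        rw [Real.rpow_sub_one (by linarith), div_eq_mul_inv, mul_comm]
        gcongr
        unfold sawtoothWeight
        rw [← one_div]
        exact min_le_left _ _
      have h5 : 1 / u * (u * ((M + 1 : ℕ) : ℝ) ^ (u - 1)) = ((M + 1 : ℕ) : ℝ) ^ (u - 1) := by
        field_simp
      have h6 := mul_le_mul_of_nonneg_left h2 (by positivity : 0 ≤ 1 / u)
      rw [h5] at h6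
      linarith
  have htail : ∀ M, H ≤ M → ∑ h ∈ range (M + 1), sawtoothWeight H h * (h : ℝ) ^ u ≤
      1 / u * (H : ℝ) ^ u + 1 / (1 - u) * ((H : ℝ) ^ u - H * (M : ℝ) ^ (-(1 - u))) := by
    intro M hM
    induction M, hM using Nat.le_induction with
    | base =>
      have : (H : ℝ) * (H : ℝ) ^ (-(1 - u)) = (H : ℝ) ^ u := by
        nth_rewrite 1 [← Real.rpow_one (H : ℝ)]
        rw [← Real.rpow_add hH0]; congr 1; ring
      rw [this, sub_self, mul_zero, add_zero]
      exact hhead H le_rfl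
    | succ M hM ih =>
      rw [sum_range_succ]
      have hM0 : (1 : ℝ) ≤ M := by exact_mod_cast hH.trans hM
      have hx : (1 : ℝ) < ((M + 1 : ℕ) : ℝ) := by push_cast; linarith
      have h2 := mul_rpow_le_rpow_sub_neg hu1'.le (by linarith) hx
      have h3 : (((M + 1 : ℕ) : ℝ) - 1) = M := by push_cast; ring
      rw [h3] at h2
      have h4 : sawtoothWeight H (M + 1) * ((M + 1 : ℕ) : ℝ) ^ u ≤
          H * ((M + 1 : ℕ) : ℝ) ^ (-(1 - u) - 1) := by
        have : ((M + 1 : ℕ) : ℝ) ^ (-(1 - u) - 1) =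
            1 / ((M + 1 : ℕ) : ℝ) ^ 2 * ((M + 1 : ℕ) : ℝ) ^ u := by
          rw [show -(1 - u) - 1 = u - 2 by ring, Real.rpow_sub (by linarith), Real.rpow_two]
          ring
        rw [this, ← mul_assoc, mul_one_div]
        gcongr
        exact min_le_right _ _
      have h5 : 1 / (1 - u) * (H * ((1 - u) * ((M + 1 : ℕ) : ℝ) ^ (-(1 - u) - 1))) =
          H * ((M + 1 : ℕ) : ℝ) ^ (-(1 - u) - 1) := by
        field_simp
      have h6 := mul_le_mul_of_nonneg_left (mul_le_mul_of_nonneg_left h2 hH0.le)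
        (by positivity : 0 ≤ 1 / (1 - u))
      rw [h5] at h6
      linarith
  have hbound : ∀ M, ∑ h ∈ range M, sawtoothWeight H h * (h : ℝ) ^ u ≤
      (1 / u + 1 / (1 - u)) * (H : ℝ) ^ u := by
    intro M
    have h1 : ∑ h ∈ range M, sawtoothWeight H h * (h : ℝ) ^ u ≤
        ∑ h ∈ range (max M H + 1), sawtoothWeight H h * (h : ℝ) ^ u := by
      apply sum_le_sum_of_subset_of_nonneg
      · intro h; simp only [mem_range]; intro hh; have := le_max_left M H; omega
      · exact fun h _ _ => hnn h
    have h2 := htail (max M H) (le_max_right _ _)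
    have h3 : 0 ≤ 1 / (1 - u) * (H * ((max M H : ℕ) : ℝ) ^ (-(1 - u))) := by positivity
    nlinarith
  exact ⟨summable_of_sum_range_le hnn hbound, Real.tsum_le_of_sum_range_le hnn hbound⟩

/-! ### Sawtooth sums of `n ^ c / d` over dyadic blocks -/

lemma hasDerivAt_fwdDiff_iter_rpow (c : ℝ) (j : ℕ) {x : ℝ} (hx : 0 < x) :
    HasDerivAt ((fwdDiff (1 : ℝ))^[j] fun t : ℝ => t ^ c)
      (c * (fwdDiff (1 : ℝ))^[j] (fun t : ℝ => t ^ (c - 1)) x) x := by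
  induction j generalizing x with
  | zero => exact Real.hasDerivAt_rpow_const (Or.inl hx.ne')
  | succ j ih =>
    rw [Function.iterate_succ_apply', Function.iterate_succ_apply']
    simp only [fwdDiff]
    rw [mul_sub]
    exact HasDerivAt.sub (HasDerivAt.comp_add_const x 1 (ih (by linarith))) (ih hx)

/-- The iterated mean value theorem for powers. -/
lemma fwdDiff_iter_rpow (j : ℕ) (c : ℝ) {x : ℝ} (hx : 0 < x) :
    ∃ ξ, x ≤ ξ ∧ ξ ≤ x + j ∧ (fwdDiff (1 : ℝ))^[j] (fun t : ℝ => t ^ c) x =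
      (descPochhammer ℝ j).eval c * ξ ^ (c - j) := by
  induction j generalizing c x with
  | zero => exact ⟨x, le_rfl, by simp, by simp⟩
  | succ j ih =>
    have hder : ∀ t ∈ Set.Ioo x (x + 1), HasDerivAt ((fwdDiff (1 : ℝ))^[j] fun t : ℝ => t ^ c)
        (c * (fwdDiff (1 : ℝ))^[j] (fun t : ℝ => t ^ (c - 1)) t) t := fun t ht =>
      hasDerivAt_fwdDiff_iter_rpow c j (hx.trans ht.1)
    have hcont : ContinuousOn ((fwdDiff (1 : ℝ))^[j] fun t : ℝ => t ^ c)
        (Set.Icc x (x + 1)) := fun t ht =>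
      (hasDerivAt_fwdDiff_iter_rpow c j (hx.trans_le ht.1)).continuousAt.continuousWithinAt
    obtain ⟨t, ht, h⟩ := exists_hasDerivAt_eq_slope _ _ (by linarith) hcont hder
    obtain ⟨ξ, h1, h2, h3⟩ := ih (c - 1) (x := t) (hx.trans ht.1)
    refine ⟨ξ, ht.1.le.trans h1, ?_, ?_⟩
    · push_cast; linarith [ht.2]
    · rw [Function.iterate_succ_apply']
      rw [h3] at h
      simp only [fwdDiff]
      rw [show x + 1 - x = 1 by ring, div_one] at h
      rw [← h, descPochhammer_succ_left]
      simp only [Polynomial.eval_mul, Polynomial.eval_X, Polynomial.eval_comp, Polynomial.eval_sub,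
        Polynomial.eval_one]
      rw [mul_assoc]
      congr 3
      push_cast; ring

lemma descPochhammer_eval_ne_zero {c : ℝ} (hc : ∀ m : ℕ, c ≠ m) (j : ℕ) :
    (descPochhammer ℝ j).eval c ≠ 0 := by
  rw [descPochhammer_eval_eq_prod_range, prod_ne_zero_iff]
  intro i _ h
  exact hc i (by linarith)

lemma rpow_bounds_of_le_two_mul (e : ℝ) {N ξ : ℝ} (hN : 0 < N) (h1 : N ≤ ξ) (h2 : ξ ≤ 2 * N) :
    2 ^ (-|e|) * N ^ e ≤ ξ ^ e ∧ ξ ^ e ≤ 2 ^ |e| * N ^ e := by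
  have hx : 1 ≤ ξ / N := by rwa [one_le_div hN]
  have hx2 : ξ / N ≤ 2 := by rwa [div_le_iff₀ hN]
  have h3 : ξ ^ e = (ξ / N) ^ e * N ^ e := by
    rw [← Real.mul_rpow (by positivity) hN.le, div_mul_cancel₀ _ hN.ne']
  have hNe := Real.rpow_nonneg hN.le e
  rw [h3]
  have h4 : (ξ / N) ^ |e| ≤ 2 ^ |e| := Real.rpow_le_rpow (by linarith) hx2 (abs_nonneg _)
  have h5 : (2 : ℝ) ^ (-|e|) ≤ (ξ / N) ^ (-|e|) :=
    Real.rpow_le_rpow_of_nonpos (by linarith) hx2 (by simp)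
  exact ⟨mul_le_mul_of_nonneg_right
      (h5.trans (Real.rpow_le_rpow_of_exponent_le hx (neg_abs_le e))) hNe,
    mul_le_mul_of_nonneg_right
      ((Real.rpow_le_rpow_of_exponent_le hx (le_abs_self e)).trans h4) hNe⟩

/-- Up to constants, the `j`-th derivative of `x ^ c` is of size `N ^ (c - j)` on `[N, 2N]`. -/
lemma exists_descPochhammer_bounds {c : ℝ} (hc : ∀ m : ℕ, c ≠ m) (k : ℕ) :
    ∃ a A : ℝ, 0 < a ∧ a ≤ A ∧ ∀ j, j ≤ k → ∀ N ξ : ℝ, 0 < N → N ≤ ξ → ξ ≤ 2 * N →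
      a * N ^ (c - j) ≤ |(descPochhammer ℝ j).eval c| * ξ ^ (c - j) ∧
      |(descPochhammer ℝ j).eval c| * ξ ^ (c - j) ≤ A * N ^ (c - j) := by
  have hsingle : ∀ j : ℕ, ∃ a A : ℝ, 0 < a ∧ a ≤ A ∧ ∀ N ξ : ℝ, 0 < N → N ≤ ξ → ξ ≤ 2 * N →
      a * N ^ (c - j) ≤ |(descPochhammer ℝ j).eval c| * ξ ^ (c - j) ∧
      |(descPochhammer ℝ j).eval c| * ξ ^ (c - j) ≤ A * N ^ (c - j) := by
    intro j
    have hp := abs_pos.2 (descPochhammer_eval_ne_zero hc j)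
    refine ⟨|(descPochhammer ℝ j).eval c| * 2 ^ (-|c - j|),
      |(descPochhammer ℝ j).eval c| * 2 ^ |c - j|, by positivity, ?_, ?_⟩
    · gcongr
      · norm_num
      · linarith [abs_nonneg (c - j)]
    · intro N ξ hN h1 h2
      obtain ⟨h3, h4⟩ := rpow_bounds_of_le_two_mul (c - j) hN h1 h2
      rw [mul_assoc, mul_assoc]
      exact ⟨by gcongr, by gcongr⟩
  induction k with
  | zero =>
    obtain ⟨a, A, ha, haA, h⟩ := hsingle 0
    refine ⟨a, A, ha, haA, fun j hj => ?_⟩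
    obtain rfl : j = 0 := by omega
    exact h
  | succ k ih =>
    obtain ⟨a, A, ha, haA, h⟩ := hsingle (k + 1)
    obtain ⟨a', A', ha', haA', h'⟩ := ih
    refine ⟨min a a', max A A', lt_min ha ha',
      (min_le_left _ _).trans (haA.trans (le_max_left _ _)), fun j hj N ξ hN h1 h2 => ?_⟩
    have hNe := Real.rpow_nonneg hN.le (c - j)
    rcases Nat.lt_or_ge k j with hlt | hle
    · obtain rfl : j = k + 1 := by omega
      obtain ⟨h3, h4⟩ := h N ξ hN h1 h2
      exact ⟨(mul_le_mul_of_nonneg_right (min_le_left _ _) hNe).trans h3,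
        h4.trans (mul_le_mul_of_nonneg_right (le_max_left _ _) hNe)⟩
    · obtain ⟨h3, h4⟩ := h' j hle N ξ hN h1 h2
      exact ⟨(mul_le_mul_of_nonneg_right (min_le_right _ _) hNe).trans h3,
        h4.trans (mul_le_mul_of_nonneg_right (le_max_right _ _) hNe)⟩

/-- Powers with a non-integral exponent are regular phases on dyadic blocks. -/
lemma exists_hasRegularDiffs_rpow {c : ℝ} (hc : ∀ m : ℕ, c ≠ m) (k : ℕ) :
    ∃ a A : ℝ, 0 < a ∧ a ≤ A ∧ ∀ (N L : ℕ) (t : ℝ), 1 ≤ N → L ≤ N → 0 < t →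
      HasRegularDiffs a A N (t * (N : ℝ) ^ c) k L (fun n => t * ((N : ℝ) + n) ^ c) := by
  obtain ⟨a, A, ha, haA, h⟩ := exists_descPochhammer_bounds hc k
  refine ⟨a, A, ha, haA, fun N L t hN hL ht j _ hj => ?_⟩
  have hN0 : (0 : ℝ) < N := by exact_mod_cast hN
  set p := (descPochhammer ℝ j).eval c with hp
  have hp0 : p ≠ 0 := descPochhammer_eval_ne_zero hc j
  have key : ∀ s : ℝ, s * p = |p| → ∀ n, n + j < L →
      a * (t * (N : ℝ) ^ c / (N : ℝ) ^ j) ≤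
        s * (fwdDiff 1)^[j] (fun n : ℕ => t * ((N : ℝ) + n) ^ c) n ∧
      s * (fwdDiff 1)^[j] (fun n : ℕ => t * ((N : ℝ) + n) ^ c) n ≤
        A * (t * (N : ℝ) ^ c / (N : ℝ) ^ j) := by
    intro s hs n hn
    have hn' : (n : ℝ) + j ≤ N := by exact_mod_cast (by omega : n + j ≤ N)
    have hn0 : (0 : ℝ) ≤ n := Nat.cast_nonneg n
    obtain ⟨ξ, h1, h2, h3⟩ := fwdDiff_iter_rpow j c (x := (N : ℝ) + n) (by positivity)
    have e : (fwdDiff 1)^[j] (fun n : ℕ => t * ((N : ℝ) + n) ^ c) n = t * (p * ξ ^ (c - j)) := by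
      rw [← h3, fwdDiff_iter_eq_sum_shift, fwdDiff_iter_eq_sum_shift, mul_sum]
      refine sum_congr rfl fun i _ => ?_
      rw [mul_smul_comm]
      congr 3
      simp; ring
    have e2 : t * (N : ℝ) ^ c / (N : ℝ) ^ j = t * (N : ℝ) ^ (c - j) := by
      rw [Real.rpow_sub hN0, Real.rpow_natCast]; ring
    have e3 : s * (t * (p * ξ ^ (c - j))) = t * (|p| * ξ ^ (c - j)) := by rw [← hs]; ring
    rw [e, e2, e3]
    obtain ⟨h4, h5⟩ := h j hj N ξ hN0 (by linarith) (by linarith)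
    constructor
    · calc _ = t * (a * (N : ℝ) ^ (c - j)) := by ring
        _ ≤ _ := by gcongr
    · calc _ ≤ t * (A * (N : ℝ) ^ (c - j)) := by gcongr
        _ = _ := by ring
  rcases lt_or_gt_of_ne hp0 with hneg | hpos
  · exact ⟨-1, Or.inr rfl, key (-1) (by rw [abs_of_neg hneg]; ring)⟩
  · exact ⟨1, Or.inl rfl, key 1 (by rw [abs_of_pos hpos]; ring)⟩

/-- The `k`-th derivative test for the phase `h n ^ c / d`; a translation by `ρ` does not change the
absolute value. -/
lemma exists_bound_expSum_rpow {c : ℝ} (hc : ∀ m : ℕ, c ≠ m) (r : ℕ) :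
    ∃ C : ℝ, 0 < C ∧ ∀ (N L d h : ℕ) (ρ : ℝ), 1 ≤ N → L ≤ N → 1 ≤ d → 1 ≤ h →
      Real.sqrt N ≤ (N : ℝ) ^ c / d →
      ‖∑ n ∈ range L, unitExp (h * (((N : ℝ) + n) ^ c / d + ρ))‖ ≤
        C * (N * (h * ((N : ℝ) ^ (c - (r + 2 : ℕ)) / d)) ^ (1 / (2 * (2 : ℝ) ^ (r + 1) - 2)) +
          (N : ℝ) ^ (1 - 1 / (2 : ℝ) ^ (r + 1))) := by
  obtain ⟨a, A, ha, haA, hreg⟩ := exists_hasRegularDiffs_rpow hc (r + 2)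
  obtain ⟨C, hC, hexp⟩ := exists_bound_regular ha haA r
  refine ⟨C, hC, fun N L d h ρ hN hL hd hh hlarge => ?_⟩
  have hN1 : (1 : ℝ) ≤ N := by exact_mod_cast hN
  have hN0 : (0 : ℝ) < N := by linarith
  have hd0 : (0 : ℝ) < d := by exact_mod_cast hd
  have hL' : (L : ℝ) ≤ N := by exact_mod_cast hL
  have hh1 : (1 : ℝ) ≤ h := by exact_mod_cast hh
  have hh0 : (0 : ℝ) < h := by linarith
  have e : ∑ n ∈ range L, unitExp (h * (((N : ℝ) + n) ^ c / d + ρ)) =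
      unitExp (h * ρ) * ∑ n ∈ range L, unitExp ((h / d) * ((N : ℝ) + n) ^ c) := by
    rw [mul_sum]
    refine sum_congr rfl fun n _ => ?_
    rw [← unitExp_add]; congr 1; ring
  rw [e, norm_mul, norm_unitExp, one_mul]
  have h1 := hexp N (h / d * (N : ℝ) ^ c) L (fun n => (h / d) * ((N : ℝ) + n) ^ c) hN1 (by
    refine hlarge.trans ?_
    rw [div_mul_eq_mul_div]
    gcongr
    exact le_mul_of_one_le_left (by positivity) hh1) hL' (hreg N L (h / d) hN hL (by positivity))
  refine h1.trans (le_of_eq ?_)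
  have e2 : (h : ℝ) / d * (N : ℝ) ^ c / (N : ℝ) ^ (r + 2) =
      h * ((N : ℝ) ^ (c - (r + 2 : ℕ)) / d) := by
    rw [Real.rpow_sub hN0, Real.rpow_natCast]; field_simp
  have e3 : (N : ℝ) * (N : ℝ) ^ (-1 / (2 : ℝ) ^ (r + 1)) =
      (N : ℝ) ^ (1 - 1 / (2 : ℝ) ^ (r + 1)) := by
    nth_rewrite 1 [← Real.rpow_one (N : ℝ)]
    rw [← Real.rpow_add hN0]; congr 1; ring
  rw [e2, mul_add, e3]

/-- The smoothing length `H` of about `q ^ (-1 / (2K - 1))` balances `1 / H` against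
`(q H) ^ (1 / (2K - 2))`. -/
lemma exists_smoothing_length {q K : ℝ} (hq : 0 < q) (hq1 : q ≤ 1) (hK : 2 ≤ K) :
    ∃ H : ℕ, 1 ≤ H ∧ 1 / (H : ℝ) ≤ q ^ (1 / (2 * K - 1)) ∧
      (H : ℝ) ≤ 2 * q ^ (-(1 / (2 * K - 1))) ∧
      q ^ (1 / (2 * K - 2)) * (H : ℝ) ^ (1 / (2 * K - 2)) ≤ 2 * q ^ (1 / (2 * K - 1)) := by
  have hK1 : 0 < 2 * K - 1 := by linarith
  have hK2 : 0 < 2 * K - 2 := by linarith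
  set w : ℝ := 1 / (2 * K - 1) with hw
  set u : ℝ := 1 / (2 * K - 2) with hu
  have hw0 : 0 < w := by positivity
  have hu0 : 0 < u := by positivity
  have hu1 : u ≤ 1 := by rw [hu, div_le_one hK2]; linarith
  have huw : u - w * u = w := by
    have hA : u * (2 * K - 2) = 1 := by rw [hu, one_div_mul_cancel hK2.ne']
    have hB : w * (2 * K - 1) = 1 := by rw [hw, one_div_mul_cancel hK1.ne']
    linear_combination w * hA - u * hB
  set y : ℝ := q ^ (-w) with hy
  have hy1 : 1 ≤ y := Real.one_le_rpow_of_pos_of_le_one_of_nonpos hq hq1 (by linarith)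
  have hHy : y ≤ ⌈y⌉₊ := Nat.le_ceil y
  have hHy2 : (⌈y⌉₊ : ℝ) ≤ 2 * y := by
    have := Nat.ceil_lt_add_one (by linarith : 0 ≤ y)
    linarith
  have hyq : q ^ w = 1 / y := by rw [hy, Real.rpow_neg hq.le, one_div, inv_inv]
  refine ⟨⌈y⌉₊, Nat.one_le_ceil_iff.2 (by linarith), ?_, hHy2, ?_⟩
  · rw [hyq]; exact one_div_le_one_div_of_le (by linarith) hHy
  · calc q ^ u * (⌈y⌉₊ : ℝ) ^ u ≤ q ^ u * (2 * y) ^ u := by gcongr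
      _ = 2 ^ u * (q ^ u * y ^ u) := by rw [Real.mul_rpow (by norm_num) (by linarith)]; ring
      _ = 2 ^ u * q ^ w := by
        rw [hy, ← Real.rpow_mul hq.le, ← Real.rpow_add hq]
        congr 2
        linarith
      _ ≤ 2 ^ (1 : ℝ) * q ^ w := by gcongr; norm_num
      _ = _ := by rw [Real.rpow_one]

lemma two_le_two_pow_succ (r : ℕ) : (2 : ℝ) ≤ 2 ^ (r + 1) := by
  rw [pow_succ]
  have : (1 : ℝ) ≤ 2 ^ r := one_le_pow₀ (by norm_num)
  linarith

/-- The sawtooth sum of `n ^ c / d` over a dyadic block, for `d` not too large. -/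
lemma exists_sawtooth_block_bound {c : ℝ} (hc : ∀ m : ℕ, c ≠ m) (r : ℕ)
    (hck : c < (r + 2 : ℕ)) {ε : ℝ} (hε : 0 < ε) :
    ∃ B : ℝ, 0 < B ∧ ∀ (N L d : ℕ) (ρ : ℝ), 1 ≤ N → L ≤ N → 1 ≤ d →
      Real.sqrt N ≤ (N : ℝ) ^ c / d →
      |∑ n ∈ range L, sawtooth (((N : ℝ) + n) ^ c / d + ρ)| ≤
        B * (N * ((N : ℝ) ^ (c - (r + 2 : ℕ)) / d) ^ (1 / (2 * (2 : ℝ) ^ (r + 1) - 1)) +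
          (N : ℝ) ^ (1 - 1 / (2 : ℝ) ^ (r + 1) + ε)) := by
  obtain ⟨C, hC, hexp⟩ := exists_bound_expSum_rpow hc r
  have hK2 := two_le_two_pow_succ r
  set K : ℝ := (2 : ℝ) ^ (r + 1) with hK
  set u : ℝ := 1 / (2 * K - 2) with hu
  have hu0 : 0 < u := by
    have : 0 < 2 * K - 2 := by linarith
    positivity
  have hu1 : u ≤ 1 / 2 := one_div_le_one_div_of_le (by norm_num) (by linarith)
  set v : ℝ := min (1 / 2) (ε / (r + 2 : ℕ)) with hv
  have hv0 : 0 < v := by positivity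
  have hv1 : v ≤ 1 / 2 := min_le_left _ _
  have hvε : (r + 2 : ℕ) * v ≤ ε := by
    rw [mul_comm, ← le_div_iff₀ (by positivity)]; exact min_le_right _ _
  have hu1' : 0 < 1 - u := by linarith
  have hv1' : 0 < 1 - v := by linarith
  set cu : ℝ := 1 / u + 1 / (1 - u) with hcu
  set cv : ℝ := 1 / v + 1 / (1 - v) with hcv
  have hcu0 : 0 < cu := by positivity
  have hcv0 : 0 < cv := by positivity
  refine ⟨(1 + 2 * C * cu) + 2 * C * cv, by positivity, fun N L d ρ hN hL hd hlarge => ?_⟩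
  have hN1 : (1 : ℝ) ≤ N := by exact_mod_cast hN
  have hN0 : (0 : ℝ) < N := by linarith
  have hd1 : (1 : ℝ) ≤ d := by exact_mod_cast hd
  have hd0 : (0 : ℝ) < d := by linarith
  have hL' : (L : ℝ) ≤ N := by exact_mod_cast hL
  set q : ℝ := (N : ℝ) ^ (c - (r + 2 : ℕ)) / d with hq
  have hq0 : 0 < q := by positivity
  have hq1 : q ≤ 1 := by
    rw [hq, div_le_one hd0]
    exact (Real.rpow_le_one_of_one_le_of_nonpos hN1 (by linarith)).trans hd1
  have hK1 : 0 < 2 * K - 1 := by linarith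
  obtain ⟨H, hH1, hHi, hHu, hbal⟩ := exists_smoothing_length hq0 hq1 hK2
  set w : ℝ := 1 / (2 * K - 1) with hw
  have hw0 : 0 < w := by positivity
  have hw1 : w ≤ 1 := by rw [hw, div_le_one hK1]; linarith
  have hqw : 0 < q ^ w := Real.rpow_pos_of_pos hq0 _
  set P := (N : ℝ) ^ (1 - 1 / K) with hP
  have hP0 : 0 < P := Real.rpow_pos_of_pos hN0 _
  set G : ℕ → ℝ := fun h => C * N * q ^ u * (h : ℝ) ^ u + C * P * (h : ℝ) ^ v with hG
  have hsum : ∀ h : ℕ, 1 ≤ h →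
      ‖∑ n ∈ range L, unitExp (h * (((N : ℝ) + n) ^ c / d + ρ))‖ ≤ G h := by
    intro h hh
    refine (hexp N L d h ρ hN hL hd hh hlarge).trans ?_
    have hh1 : (1 : ℝ) ≤ h := by exact_mod_cast hh
    rw [Real.mul_rpow (by linarith) hq0.le]
    have h4 : C * P ≤ C * P * (h : ℝ) ^ v :=
      le_mul_of_one_le_right (by positivity) (Real.one_le_rpow hh1 hv0.le)
    calc _ = C * N * q ^ u * (h : ℝ) ^ u + C * P := by ring
      _ ≤ _ := add_le_add le_rfl h4
  obtain ⟨hs1, hb1⟩ := summable_sawtoothWeight hu0 (by linarith) hH1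
  obtain ⟨hs2, hb2⟩ := summable_sawtoothWeight hv0 (by linarith) hH1
  have eG : (fun h => sawtoothWeight H h * G h) = fun h =>
      C * N * q ^ u * (sawtoothWeight H h * (h : ℝ) ^ u) +
      C * P * (sawtoothWeight H h * (h : ℝ) ^ v) := by
    ext h; simp only [hG]; ring
  have hs : Summable fun h => sawtoothWeight H h * G h := by
    rw [eG]
    exact (hs1.mul_left _).add (hs2.mul_left _)
  refine (abs_sum_sawtooth_le (fun n => ((N : ℝ) + n) ^ c / d + ρ) L hH1 hsum hs).trans ?_
  have htsum : ∑' h, sawtoothWeight H h * G h ≤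
      C * N * q ^ u * (cu * (H : ℝ) ^ u) + C * P * (cv * (H : ℝ) ^ v) := by
    rw [eG, (hs1.mul_left _).tsum_add (hs2.mul_left _), tsum_mul_left, tsum_mul_left]
    gcongr
  have hHv : (H : ℝ) ^ v ≤ 2 * (N : ℝ) ^ ε := by
    have hyN : q ^ (-w) ≤ (N : ℝ) ^ ((r + 2 : ℕ) : ℝ) := by
      have hdN : (d : ℝ) ≤ (N : ℝ) ^ c := by
        have h1 : 1 ≤ (N : ℝ) ^ c / d := (Real.one_le_sqrt.2 hN1).trans hlarge
        rwa [one_le_div hd0] at h1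
      have hqi : (N : ℝ) ^ (-((r + 2 : ℕ) : ℝ)) ≤ q := by
        rw [hq, le_div_iff₀ hd0]
        calc _ ≤ (N : ℝ) ^ (-((r + 2 : ℕ) : ℝ)) * (N : ℝ) ^ c := by gcongr
          _ = _ := by rw [← Real.rpow_add hN0]; congr 1; ring
      calc q ^ (-w) ≤ ((N : ℝ) ^ (-((r + 2 : ℕ) : ℝ))) ^ (-w) :=
            Real.rpow_le_rpow_of_nonpos (by positivity) hqi (by linarith)
        _ = (N : ℝ) ^ (((r + 2 : ℕ) : ℝ) * w) := by
            rw [← Real.rpow_mul hN0.le]; congr 1; ring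
        _ ≤ _ := by
          apply Real.rpow_le_rpow_of_exponent_le hN1
          exact mul_le_of_le_one_right (by positivity) hw1
    calc (H : ℝ) ^ v ≤ (2 * (N : ℝ) ^ ((r + 2 : ℕ) : ℝ)) ^ v := by
          gcongr; linarith
      _ = 2 ^ v * (N : ℝ) ^ (((r + 2 : ℕ) : ℝ) * v) := by
          rw [Real.mul_rpow (by norm_num) (by positivity), ← Real.rpow_mul hN0.le]
      _ ≤ 2 ^ (1 : ℝ) * (N : ℝ) ^ ε := by
          apply mul_le_mul _ (Real.rpow_le_rpow_of_exponent_le hN1 hvε) (by positivity)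
            (by positivity)
          exact Real.rpow_le_rpow_of_exponent_le (by norm_num) (by linarith)
      _ = _ := by rw [Real.rpow_one]
  have hLH : (L : ℝ) / H ≤ N * q ^ w := by
    rw [div_eq_mul_one_div]
    gcongr
  have e4 : (N : ℝ) ^ (1 - 1 / K + ε) = P * (N : ℝ) ^ ε := Real.rpow_add hN0 _ _
  rw [e4]
  clear_value P
  have hNq : 0 < (N : ℝ) * q ^ w := by positivity
  have hZ : 0 < P * (N : ℝ) ^ ε := by positivity
  have t1 : C * N * q ^ u * (cu * (H : ℝ) ^ u) ≤ 2 * C * cu * (N * q ^ w) := by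
    calc _ = C * N * cu * (q ^ u * (H : ℝ) ^ u) := by ring
      _ ≤ C * N * cu * (2 * q ^ w) := by gcongr
      _ = _ := by ring
  have t2 : C * P * (cv * (H : ℝ) ^ v) ≤ 2 * C * cv * (P * (N : ℝ) ^ ε) := by
    calc _ ≤ C * P * (cv * (2 * (N : ℝ) ^ ε)) := by gcongr
      _ = _ := by ring
  have p1 : 0 < C * cu := by positivity
  have p2 : 0 < C * cv := by positivity
  calc _ ≤ N * q ^ w + (2 * C * cu * (N * q ^ w) + 2 * C * cv * (P * (N : ℝ) ^ ε)) :=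
        add_le_add hLH (htsum.trans (add_le_add t1 t2))
    _ = (1 + 2 * C * cu) * (N * q ^ w) + 2 * C * cv * (P * (N : ℝ) ^ ε) := by ring
    _ ≤ ((1 + 2 * C * cu) + 2 * C * cv) * (N * q ^ w) +
        ((1 + 2 * C * cu) + 2 * C * cv) * (P * (N : ℝ) ^ ε) := by
        exact add_le_add (mul_le_mul_of_nonneg_right (by linarith) hNq.le)
          (mul_le_mul_of_nonneg_right (by linarith) hZ.le)
    _ = _ := by ring

/-! ### Counting the `n` with `d ∣ [n ^ c]` -/

/-- `d ∣ ⌊y⌋` exactly when `{y / d} < 1 / d`. -/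
lemma dvd_floor_indicator {y : ℝ} (hy : 0 ≤ y) {d : ℕ} (hd : 1 ≤ d) :
    (if d ∣ ⌊y⌋₊ then (1 : ℝ) else 0) =
      sawtooth (y / d + -(1 / d)) - sawtooth (y / d + 0) + 1 / d := by
  have hd1 : (1 : ℝ) ≤ d := by exact_mod_cast hd
  have hd0 : (0 : ℝ) < d := by linarith
  set a := ⌊y⌋₊ with ha
  have h1 : (a : ℝ) ≤ y := Nat.floor_le hy
  have h2 : y < a + 1 := Nat.lt_floor_add_one y
  have hmod : (d : ℝ) * ((a / d : ℕ) : ℝ) + ((a % d : ℕ) : ℝ) = a := by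
    exact_mod_cast Nat.div_add_mod a d
  have hlt : ((a % d : ℕ) : ℝ) + 1 ≤ d := by exact_mod_cast Nat.mod_lt a hd
  have hfr : Int.fract (y / d) = y / d - (a / d : ℕ) := by
    rw [Int.fract_eq_iff]
    refine ⟨?_, ?_, (a / d : ℕ), by rw [Int.cast_natCast]; ring⟩
    · rw [sub_nonneg, le_div_iff₀ hd0]
      have : (0 : ℝ) ≤ ((a % d : ℕ) : ℝ) := Nat.cast_nonneg _
      linarith
    · rw [sub_lt_iff_lt_add, div_lt_iff₀ hd0]
      linarith
  unfold sawtooth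
  rw [add_zero, hfr]
  split_ifs with h
  · have hm : ((a % d : ℕ) : ℝ) = 0 := by exact_mod_cast Nat.mod_eq_zero_of_dvd h
    have : Int.fract (y / d + -(1 / d)) = y / d + -(1 / d) - ((a / d : ℕ) : ℝ) + 1 := by
      rw [Int.fract_eq_iff]
      refine ⟨?_, ?_, (a / d : ℕ) - 1,
        by rw [Int.cast_sub, Int.cast_natCast, Int.cast_one]; ring⟩
      · have : 1 / (d : ℝ) ≤ 1 := by rw [div_le_one hd0]; exact hd1
        have h3 : ((a / d : ℕ) : ℝ) ≤ y / d := by rw [le_div_iff₀ hd0]; linarith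
        linarith
      · have : y / d < (a / d : ℕ) + 1 / d := by
          rw [div_lt_iff₀ hd0, add_mul, one_div_mul_cancel hd0.ne']; linarith
        linarith
    rw [this]; ring
  · have hm : (1 : ℝ) ≤ ((a % d : ℕ) : ℝ) := by
      exact_mod_cast Nat.one_le_iff_ne_zero.2 fun h0 => h (Nat.dvd_of_mod_eq_zero h0)
    have : Int.fract (y / d + -(1 / d)) = y / d + -(1 / d) - ((a / d : ℕ) : ℝ) := by
      rw [Int.fract_eq_iff]
      refine ⟨?_, ?_, (a / d : ℕ), by rw [Int.cast_natCast]; ring⟩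
      · have : (a / d : ℕ) + 1 / (d : ℝ) ≤ y / d := by
          rw [le_div_iff₀ hd0, add_mul, one_div_mul_cancel hd0.ne']; linarith
        linarith
      · have : y / d - (a / d : ℕ) < 1 := by
          rw [sub_lt_iff_lt_add, div_lt_iff₀ hd0]
          linarith
        have : 0 < 1 / (d : ℝ) := by positivity
        linarith
    rw [this]; ring

lemma piatetskiShapiro_lt_succ {c : ℝ} (hc : 1 ≤ c) (n : ℕ) :
    piatetskiShapiro c n < piatetskiShapiro c (n + 1) := by
  unfold piatetskiShapiro
  have h := Real.add_rpow_le_rpow_add (Nat.cast_nonneg n) zero_le_one hc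
  rw [Real.one_rpow] at h
  have h1 : ⌊(n : ℝ) ^ c⌋₊ + 1 = ⌊(n : ℝ) ^ c + 1⌋₊ := (Nat.floor_add_one (by positivity)).symm
  have h2 : ⌊(n : ℝ) ^ c + 1⌋₊ ≤ ⌊((n + 1 : ℕ) : ℝ) ^ c⌋₊ :=
    Nat.floor_le_floor (by push_cast; exact h)
  omega

lemma piatetskiShapiro_strictMono {c : ℝ} (hc : 1 ≤ c) : StrictMono (piatetskiShapiro c) :=
  strictMono_nat_of_lt_succ (piatetskiShapiro_lt_succ hc)

lemma piatetskiShapiro_pos {c : ℝ} (hc : 1 ≤ c) {n : ℕ} (hn : 1 ≤ n) :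
    1 ≤ piatetskiShapiro c n :=
  Nat.one_le_iff_ne_zero.2 fun h => by
    have := piatetskiShapiro_strictMono hc (show 0 < n by omega)
    omega

/-- Distinct `n` give distinct values, so at most `y / d` values up to `y` are divisible by `d`. -/
lemma card_dvd_piatetskiShapiro_le {c : ℝ} (hc : 1 ≤ c) {d : ℕ} (hd : 1 ≤ d) (s : Finset ℕ)
    {M : ℕ} (hs : ∀ n ∈ s, 1 ≤ n ∧ n ≤ M) :
    (#(s.filter fun n => d ∣ piatetskiShapiro c n) : ℝ) ≤ (M : ℝ) ^ c / d := by
  have hd0 : (0 : ℝ) < d := by exact_mod_cast hd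
  have h1 : #(s.filter fun n => d ∣ piatetskiShapiro c n) ≤
      #(Finset.Icc 1 ⌊(M : ℝ) ^ c / d⌋₊) := by
    apply card_le_card_of_injOn (fun n => piatetskiShapiro c n / d)
    · intro n hn
      rw [mem_coe, mem_filter] at hn
      obtain ⟨hn1, hn2⟩ := hs n hn.1
      rw [mem_coe, Finset.mem_Icc]
      constructor
      · exact Nat.div_pos (Nat.le_of_dvd (piatetskiShapiro_pos hc hn1) hn.2) hd
      · apply Nat.le_floor
        rw [le_div_iff₀ hd0]
        calc ((piatetskiShapiro c n / d : ℕ) : ℝ) * d ≤ piatetskiShapiro c n := by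
              exact_mod_cast Nat.div_mul_le_self _ _
          _ ≤ (n : ℝ) ^ c := Nat.floor_le (by positivity)
          _ ≤ (M : ℝ) ^ c := by gcongr
    · intro m hm n hn h
      rw [mem_coe, mem_filter] at hm hn
      simp only at h
      exact (piatetskiShapiro_strictMono hc).injective (Nat.div_left_inj hm.2 hn.2 |>.1 h)
  rw [Nat.card_Icc, Nat.add_sub_cancel] at h1
  calc _ ≤ (⌊(M : ℝ) ^ c / d⌋₊ : ℝ) := by exact_mod_cast h1
    _ ≤ _ := Nat.floor_le (by positivity)

/-- The number of `n ≤ X` with `d ∣ [n ^ c]`. -/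
noncomputable def divCount (c : ℝ) (d X : ℕ) : ℕ :=
  #((Finset.Icc 1 X).filter fun n => d ∣ piatetskiShapiro c n)

/-- Equidistribution on a dyadic block. If `N ^ c / d < √N`, both the count and its expected value
are of order at most `√N ≤ N ^ (1 - 1/K)`. -/
lemma exists_block_count_bound {c : ℝ} (hc : ∀ m : ℕ, c ≠ m) (hc1 : 1 ≤ c) (r : ℕ)
    (hck : c < (r + 2 : ℕ)) {ε : ℝ} (hε : 0 < ε) :
    ∃ B : ℝ, 0 < B ∧ ∀ N L d : ℕ, 1 ≤ N → L ≤ N → 1 ≤ d →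
      |(#((range L).filter fun n => d ∣ piatetskiShapiro c (N + n)) : ℝ) - L / d| ≤
        B * (N * ((N : ℝ) ^ (c - (r + 2 : ℕ)) / d) ^ (1 / (2 * (2 : ℝ) ^ (r + 1) - 1)) +
          (N : ℝ) ^ (1 - 1 / (2 : ℝ) ^ (r + 1) + ε)) := by
  obtain ⟨B, hB, h⟩ := exists_sawtooth_block_bound hc r hck hε
  refine ⟨2 * B + 2 ^ c + 1, by positivity, fun N L d hN hL hd => ?_⟩
  have hN1 : (1 : ℝ) ≤ N := by exact_mod_cast hN
  have hN0 : (0 : ℝ) < N := by linarith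
  have hd0 : (0 : ℝ) < d := by exact_mod_cast hd
  have hL' : (L : ℝ) ≤ N := by exact_mod_cast hL
  have hK2 := two_le_two_pow_succ r
  set P := (N : ℝ) * ((N : ℝ) ^ (c - (r + 2 : ℕ)) / d) ^ (1 / (2 * (2 : ℝ) ^ (r + 1) - 1)) with hP
  set R := (N : ℝ) ^ (1 - 1 / (2 : ℝ) ^ (r + 1) + ε) with hR
  have hP0 : 0 ≤ P := by positivity
  have hR0 : 0 ≤ R := by positivity
  have h2c : (0 : ℝ) < 2 ^ c := by positivity
  rcases le_or_gt (Real.sqrt N) ((N : ℝ) ^ c / d) with hcase | hcase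
  · have e : (#((range L).filter fun n => d ∣ piatetskiShapiro c (N + n)) : ℝ) - L / d =
        ∑ n ∈ range L, sawtooth (((N : ℝ) + n) ^ c / d + -(1 / d)) -
        ∑ n ∈ range L, sawtooth (((N : ℝ) + n) ^ c / d + 0) := by
      rw [card_filter, ← sum_sub_distrib]
      push_cast
      have : ∀ n : ℕ, (if d ∣ piatetskiShapiro c (N + n) then (1 : ℝ) else 0) =
          sawtooth (((N : ℝ) + n) ^ c / d + -(1 / d)) - sawtooth (((N : ℝ) + n) ^ c / d + 0) +
            1 / d := by
        intro n
        rw [← dvd_floor_indicator (by positivity) hd]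
        simp [piatetskiShapiro]
      rw [sum_congr rfl fun n _ => this n, sum_add_distrib, sum_const, card_range, nsmul_eq_mul]
      ring
    rw [e]
    refine (abs_sub _ _).trans ?_
    have h1 := h N L d (-(1 / d)) hN hL hd hcase
    have h2 := h N L d 0 hN hL hd hcase
    nlinarith
  · have hNR : Real.sqrt N ≤ R := by
      rw [Real.sqrt_eq_rpow, hR]
      apply Real.rpow_le_rpow_of_exponent_le hN1
      have : 1 / (2 : ℝ) ^ (r + 1) ≤ 1 / 2 := one_div_le_one_div_of_le (by norm_num) hK2
      linarith
    have h1 : (#((range L).filter fun n => d ∣ piatetskiShapiro c (N + n)) : ℝ) ≤ 2 ^ c * R := by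
      have h3 := card_dvd_piatetskiShapiro_le hc1 hd ((range L).image (N + ·)) (M := 2 * N) (by
        intro n hn
        simp only [mem_image, mem_range] at hn
        omega)
      rw [filter_image, card_image_of_injective _ (add_right_injective N)] at h3
      refine h3.trans ?_
      push_cast
      rw [Real.mul_rpow (by norm_num) hN0.le, mul_div_assoc]
      gcongr
      linarith
    have h2 : (L : ℝ) / d ≤ R := by
      refine le_trans ?_ (hcase.le.trans hNR)
      gcongr
      calc (L : ℝ) ≤ N := hL'
        _ = (N : ℝ) ^ (1 : ℝ) := (Real.rpow_one _).symm
        _ ≤ _ := Real.rpow_le_rpow_of_exponent_le hN1 hc1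
    have h4 : 0 ≤ (L : ℝ) / d := by positivity
    have h5 : (0 : ℝ) ≤ #((range L).filter fun n => d ∣ piatetskiShapiro c (N + n)) :=
      Nat.cast_nonneg _
    have h6 : 0 ≤ (2 * B + 2 ^ c + 1) * P := by positivity
    have h7 : 0 ≤ B * R := by positivity
    have h8 : 0 ≤ 2 ^ c * R := by positivity
    rw [abs_le]
    constructor <;> nlinarith

/-- Summation over dyadic blocks `(X/2, X]`: positive powers of `X` lose only a constant. -/
lemma abs_le_of_halving {G : ℕ → ℝ} (hG0 : G 0 = 0) {B a b u v w : ℝ} (hB : 0 ≤ B) (ha : 0 ≤ a)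
    (hb : 0 ≤ b) (hw : 0 < w) (hu : w ≤ u) (hv : w ≤ v)
    (h : ∀ X : ℕ, 1 ≤ X → |G X - G (X / 2)| ≤ B * (a * (X : ℝ) ^ u + b * (X : ℝ) ^ v)) (X : ℕ) :
    |G X| ≤ B / (1 - 2 ^ (-w)) * (a * (X : ℝ) ^ u + b * (X : ℝ) ^ v) := by
  have h2 : (2 : ℝ) ^ (-w) < 1 := Real.rpow_lt_one_of_one_lt_of_neg (by norm_num) (by linarith)
  have h2' : 0 < 1 - (2 : ℝ) ^ (-w) := by linarith
  induction X using Nat.strong_induction_on with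
  | _ X ih =>
    rcases Nat.eq_zero_or_pos X with rfl | hX
    · rw [hG0, abs_zero]; positivity
    have hhalf : ∀ e, w ≤ e → ((X / 2 : ℕ) : ℝ) ^ e ≤ 2 ^ (-w) * (X : ℝ) ^ e := by
      intro e he
      have h3 : ((X / 2 : ℕ) : ℝ) ≤ 2⁻¹ * X := by
        have := Nat.cast_div_le (α := ℝ) (m := X) (n := 2)
        push_cast at this; linarith
      calc ((X / 2 : ℕ) : ℝ) ^ e ≤ (2⁻¹ * X) ^ e := by gcongr; linarith
        _ = 2 ^ (-e) * (X : ℝ) ^ e := by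
          rw [Real.mul_rpow (by norm_num) (by positivity), Real.inv_rpow (by norm_num),
            Real.rpow_neg (by norm_num)]
        _ ≤ _ := by
          gcongr
          norm_num
    have h3 := ih (X / 2) (by omega)
    have h4 := h X hX
    have h5 : |G X| ≤ |G X - G (X / 2)| + |G (X / 2)| := by
      have := abs_add_le (G X - G (X / 2)) (G (X / 2)); rwa [sub_add_cancel] at this
    set Y := a * (X : ℝ) ^ u + b * (X : ℝ) ^ v with hY
    have h6 : a * ((X / 2 : ℕ) : ℝ) ^ u + b * ((X / 2 : ℕ) : ℝ) ^ v ≤ 2 ^ (-w) * Y := by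
      have e1 := mul_le_mul_of_nonneg_left (hhalf u hu) ha
      have e2 := mul_le_mul_of_nonneg_left (hhalf v hv) hb
      rw [hY]; nlinarith
    calc |G X| ≤ B * Y + B / (1 - 2 ^ (-w)) * (2 ^ (-w) * Y) := by
          refine h5.trans (add_le_add h4 (h3.trans ?_))
          gcongr
      _ = B / (1 - 2 ^ (-w)) * Y := by field_simp; ring

/-- Equidistribution of `[n ^ c]` in the class `0` modulo `d`, uniformly in `d`. -/
theorem exists_divCount_bound {c : ℝ} (hc : ∀ m : ℕ, c ≠ m) (hc1 : 1 ≤ c) (r : ℕ)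
    (hck : c < (r + 2 : ℕ)) {ε : ℝ} (hε : 0 < ε) :
    ∃ B : ℝ, 0 < B ∧ ∀ X d : ℕ, 1 ≤ d →
      |(divCount c d X : ℝ) - X / d| ≤
        B * ((d : ℝ) ^ (-(1 / (2 * (2 : ℝ) ^ (r + 1) - 1))) *
          (X : ℝ) ^ (1 - ((r + 2 : ℕ) - c) / (2 * (2 : ℝ) ^ (r + 1) - 1)) +
          (X : ℝ) ^ (1 - 1 / (2 : ℝ) ^ (r + 1) + ε)) := by
  obtain ⟨B, hB, h⟩ := exists_block_count_bound hc hc1 r hck hε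
  have hK2 := two_le_two_pow_succ r
  set K : ℝ := (2 : ℝ) ^ (r + 1) with hK
  have hKr : (r : ℝ) + 2 ≤ K := by
    have : r + 2 ≤ 2 ^ (r + 1) := Nat.succ_le_of_lt (Nat.lt_two_pow_self)
    rw [hK]; exact_mod_cast this
  have hK1 : 0 < 2 * K - 1 := by linarith
  set w : ℝ := 1 / (2 * K - 1) with hw
  have hw0 : 0 < w := by positivity
  set u : ℝ := 1 - ((r + 2 : ℕ) - c) / (2 * K - 1) with hu
  set v : ℝ := 1 - 1 / K + ε with hv
  have hu0 : 0 < u := by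
    rw [hu, sub_pos, div_lt_one hK1]; push_cast; linarith
  have hv0 : 0 < v := by
    have : 1 / K ≤ 1 / 2 := one_div_le_one_div_of_le (by norm_num) hK2
    rw [hv]; linarith
  have h2 : (2 : ℝ) ^ (-(min u v)) < 1 := by
    have : 0 < min u v := lt_min hu0 hv0
    exact Real.rpow_lt_one_of_one_lt_of_neg (by norm_num) (by linarith)
  refine ⟨B / (1 - 2 ^ (-(min u v))), div_pos hB (by linarith), fun X d hd => ?_⟩
  have hd0 : (0 : ℝ) < d := by exact_mod_cast hd
  have key := abs_le_of_halving (G := fun X => (divCount c d X : ℝ) - X / d)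
    (by simp [divCount]) hB.le (a := (d : ℝ) ^ (-w)) (b := 1) (u := u) (v := v) (by positivity)
    zero_le_one (lt_min hu0 hv0) (min_le_left _ _) (min_le_right _ _) (by
      intro X hX
      -- the block `(X/2, X]` starts at `N = X/2 + 1` and has length `X - X/2 ≤ N`
      have hN1 : (1 : ℝ) ≤ ((X / 2 + 1 : ℕ) : ℝ) := by exact_mod_cast Nat.succ_pos (X / 2)
      have hNX : ((X / 2 + 1 : ℕ) : ℝ) ≤ X := by exact_mod_cast (by omega : X / 2 + 1 ≤ X)
      have h1 := h (X / 2 + 1) (X - X / 2) d (by omega) (by omega) hd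
      have e1 : divCount c d X = divCount c d (X / 2) +
          #((range (X - X / 2)).filter fun n => d ∣ piatetskiShapiro c (X / 2 + 1 + n)) := by
        unfold divCount
        rw [card_filter, card_filter, card_filter]
        have e2 : ∑ i ∈ range (X - X / 2),
            (if d ∣ piatetskiShapiro c (X / 2 + 1 + i) then 1 else 0) =
            ∑ i ∈ Ico (X / 2 + 1) (X + 1), (if d ∣ piatetskiShapiro c i then 1 else 0) := by
          rw [sum_Ico_eq_sum_range, show X + 1 - (X / 2 + 1) = X - X / 2 by omega]
        rw [e2]
        have e3 : ∀ Y : ℕ, Finset.Icc 1 Y = Ico 1 (Y + 1) := by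
          intro Y; ext; simp only [Finset.mem_Icc, Finset.mem_Ico]; omega
        rw [e3, e3, sum_Ico_consecutive _ (by omega) (by omega)]
      have e4 : ((X - X / 2 : ℕ) : ℝ) = X - (X / 2 : ℕ) := Nat.cast_sub (Nat.div_le_self _ _)
      have e5 : (divCount c d X : ℝ) - X / d - ((divCount c d (X / 2) : ℝ) - (X / 2 : ℕ) / d) =
          (#((range (X - X / 2)).filter fun n => d ∣ piatetskiShapiro c (X / 2 + 1 + n)) : ℝ) -
          (X - X / 2 : ℕ) / d := by
        rw [e1, e4]; push_cast; ring
      rw [e5]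
      refine h1.trans ?_
      set N : ℝ := ((X / 2 + 1 : ℕ) : ℝ)
      have hN0 : 0 < N := by linarith
      have e6 : N * (N ^ (c - (r + 2 : ℕ)) / d) ^ w = d ^ (-w) * N ^ u := by
        have : u = 1 + (c - (r + 2 : ℕ)) * w := by rw [hu, hw]; ring
        rw [this, Real.div_rpow (by positivity) hd0.le, ← Real.rpow_mul hN0.le,
          Real.rpow_neg hd0.le, Real.rpow_add hN0, Real.rpow_one]
        ring
      rw [e6, one_mul]
      gcongr)
  have := key X
  rwa [one_mul] at this

/-! ### The divisor bound and Möbius inversion -/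

/-- The divisor bound. A prime `p ≥ 2 ^ (1 / ε)` contributes `v + 1 ≤ 2 ^ v ≤ p ^ (ε v)`, and
each of the finitely many others loses at most a constant factor. -/
theorem exists_card_divisors_le {ε : ℝ} (hε : 0 < ε) :
    ∃ C : ℝ, 0 < C ∧ ∀ n : ℕ, 1 ≤ n → (#n.divisors : ℝ) ≤ C * (n : ℝ) ^ ε := by
  have hlog : 0 < Real.log 2 := Real.log_pos (by norm_num)
  set A : ℝ := 1 + 1 / (ε * Real.log 2) with hA
  have hA1 : 1 ≤ A := by
    have : 0 < 1 / (ε * Real.log 2) := by positivity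
    linarith
  set P : ℕ := ⌈(2 : ℝ) ^ (1 / ε)⌉₊ with hP
  refine ⟨A ^ P, by positivity, fun n hn => ?_⟩
  have hn0 : n ≠ 0 := by omega
  rw [Nat.card_divisors hn0]
  push_cast
  have hpow : (n : ℝ) ^ ε = ∏ p ∈ n.primeFactors, ((p : ℝ) ^ (n.factorization p)) ^ ε := by
    rw [Real.finsetProd_rpow _ _ (fun p _ => by positivity)]
    congr 1
    have := Nat.prod_factorization_pow_eq_self hn0
    rw [Finsupp.prod, Nat.support_factorization] at this
    exact_mod_cast this.symm
  have hterm : ∀ p ∈ n.primeFactors, ((n.factorization p : ℝ) + 1) ≤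
      (if p < P then A else 1) * ((p : ℝ) ^ (n.factorization p)) ^ ε := by
    intro p hp
    have hp2 : (2 : ℝ) ≤ p := by exact_mod_cast (Nat.prime_of_mem_primeFactors hp).two_le
    set v := n.factorization p
    have e : ((p : ℝ) ^ v) ^ ε = ((p : ℝ) ^ ε) ^ v := by
      rw [← Real.rpow_natCast, ← Real.rpow_natCast, ← Real.rpow_mul (by linarith),
        ← Real.rpow_mul (by linarith), mul_comm]
    split_ifs with h
    · have h1 : 1 + ε * Real.log 2 * v ≤ ((p : ℝ) ^ v) ^ ε := by
        calc 1 + ε * Real.log 2 * v ≤ Real.exp (ε * Real.log 2 * v) := by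
              rw [add_comm]; exact Real.add_one_le_exp _
          _ = (2 : ℝ) ^ (v * ε) := by
              rw [Real.rpow_def_of_pos (by norm_num)]; congr 1; ring
          _ ≤ (p : ℝ) ^ (v * ε) := Real.rpow_le_rpow (by norm_num) hp2 (by positivity)
          _ = _ := by rw [← Real.rpow_natCast, ← Real.rpow_mul (by linarith)]
      refine le_trans ?_ (mul_le_mul_of_nonneg_left h1 (by linarith))
      have h2 : 1 / (ε * Real.log 2) * (ε * Real.log 2 * v) = v := by field_simp
      have h3 : 0 ≤ ε * Real.log 2 * v := by positivity
      have h4 : 0 < 1 / (ε * Real.log 2) := by positivity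
      rw [hA]; nlinarith
    · rw [one_mul, e]
      have h1 : (2 : ℝ) ≤ (p : ℝ) ^ ε := by
        have h2 : (2 : ℝ) ^ (1 / ε) ≤ p := (Nat.le_ceil _).trans (by exact_mod_cast not_lt.1 h)
        calc (2 : ℝ) = ((2 : ℝ) ^ (1 / ε)) ^ ε := by
              rw [← Real.rpow_mul (by norm_num), one_div_mul_cancel hε.ne', Real.rpow_one]
          _ ≤ _ := by gcongr
      calc (v : ℝ) + 1 ≤ 2 ^ v := by exact_mod_cast Nat.lt_two_pow_self
        _ ≤ _ := by gcongr
  refine (prod_le_prod (fun p _ => by positivity) hterm).trans ?_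
  rw [prod_mul_distrib, ← hpow]
  gcongr
  rw [← prod_filter, prod_const]
  apply pow_le_pow_right₀ hA1
  calc _ ≤ #(range P) := card_le_card (by
        intro p; simp only [mem_filter, mem_range]; exact fun h => h.2)
    _ = P := card_range P

/-- Möbius inversion for the number of coprime pairs. -/
lemma card_coprime_pairs_eq_sum (a : ℕ → ℕ) (s : Finset ℕ) (M : ℕ)
    (ha : ∀ n ∈ s, 1 ≤ a n ∧ a n ≤ M) :
    (#((s ×ˢ s).filter fun p : ℕ × ℕ => Nat.Coprime (a p.1) (a p.2)) : ℝ) =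
      ∑ d ∈ Finset.Icc 1 M, (ArithmeticFunction.moebius d : ℝ) *
        (#(s.filter fun n => d ∣ a n) : ℝ) ^ 2 := by
  have hsq : ∀ f : ℕ → ℝ, ∑ p ∈ s ×ˢ s, f p.1 * f p.2 = (∑ n ∈ s, f n) ^ 2 := by
    intro f
    rw [sum_product, sq, sum_mul_sum]
  have h1 : ∀ p ∈ s ×ˢ s, (if Nat.Coprime (a p.1) (a p.2) then (1 : ℝ) else 0) =
      ∑ d ∈ Finset.Icc 1 M, (ArithmeticFunction.moebius d : ℝ) *
        ((if d ∣ a p.1 then 1 else 0) * (if d ∣ a p.2 then 1 else 0)) := by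
    intro p hp
    rw [mem_product] at hp
    obtain ⟨h1, h2⟩ := ha _ hp.1
    have hg : Nat.gcd (a p.1) (a p.2) ≠ 0 := Nat.gcd_ne_zero_left (by omega)
    have h3 : ∑ d ∈ (Nat.gcd (a p.1) (a p.2)).divisors, ArithmeticFunction.moebius d =
        if Nat.gcd (a p.1) (a p.2) = 1 then 1 else 0 := by
      rw [← ArithmeticFunction.coe_mul_zeta_apply, ArithmeticFunction.moebius_mul_coe_zeta,
        ArithmeticFunction.one_apply]
    have h4 : (Nat.gcd (a p.1) (a p.2)).divisors =
        (Finset.Icc 1 M).filter fun d => d ∣ a p.1 ∧ d ∣ a p.2 := by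
      ext d
      rw [Nat.mem_divisors, mem_filter, Finset.mem_Icc, Nat.dvd_gcd_iff]
      constructor
      · rintro ⟨⟨h5, h6⟩, _⟩
        exact ⟨⟨Nat.pos_of_dvd_of_pos h5 (by omega), (Nat.le_of_dvd (by omega) h5).trans h2⟩,
          h5, h6⟩
      · rintro ⟨_, h5⟩
        exact ⟨h5, hg⟩
    rw [h4, sum_filter] at h3
    have h5 : (if Nat.Coprime (a p.1) (a p.2) then (1 : ℝ) else 0) =
        ((if Nat.gcd (a p.1) (a p.2) = 1 then 1 else 0 : ℤ) : ℝ) := by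
      simp only [Nat.coprime_iff_gcd_eq_one]; push_cast; rfl
    rw [h5, ← h3, Int.cast_sum]
    refine sum_congr rfl fun d _ => ?_
    by_cases h6 : d ∣ a p.1 <;> by_cases h7 : d ∣ a p.2 <;> simp [h6, h7]
  rw [card_filter, Nat.cast_sum]
  push_cast
  rw [sum_congr rfl h1, sum_comm]
  refine sum_congr rfl fun d _ => ?_
  rw [← mul_sum, hsq fun n => if d ∣ a n then (1 : ℝ) else 0, card_filter]
  push_cast
  rfl

lemma coprimePairCount_eq_sum {c : ℝ} (hc : 1 ≤ c) (x : ℝ) :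
    (coprimePairCount c x : ℝ) = ∑ d ∈ Finset.Icc 1 (piatetskiShapiro c ⌊x⌋₊),
      (ArithmeticFunction.moebius d : ℝ) * (divCount c d ⌊x⌋₊ : ℝ) ^ 2 := by
  unfold coprimePairCount divCount
  refine card_coprime_pairs_eq_sum _ _ _ fun n hn => ?_
  rw [Finset.mem_Icc] at hn
  exact ⟨piatetskiShapiro_pos hc hn.1, (piatetskiShapiro_strictMono hc).monotone hn.2⟩

lemma abs_moebius_le_one (d : ℕ) : |(ArithmeticFunction.moebius d : ℝ)| ≤ 1 := by
  exact_mod_cast ArithmeticFunction.abs_moebius_le_one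

/-- `∑ μ(d) / d²` over `d ≤ M` is within `1 / M` of its limit `1 / ζ(2)`. -/
lemma exists_moebius_sum :
    ∃ m₀ : ℝ, (m₀ : ℂ) = 1 / riemannZeta 2 ∧ ∀ M : ℕ, 1 ≤ M →
      |m₀ - ∑ d ∈ Finset.Icc 1 M, (ArithmeticFunction.moebius d : ℝ) / (d : ℝ) ^ 2| ≤ 1 / M := by
  have hsum : Summable fun d : ℕ => (ArithmeticFunction.moebius d : ℝ) / (d : ℝ) ^ 2 := by
    refine Summable.of_norm_bounded (Real.summable_one_div_nat_pow.2 one_lt_two) fun d => ?_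
    rw [norm_div, norm_pow, Real.norm_natCast, Real.norm_eq_abs]
    gcongr
    exact abs_moebius_le_one d
  refine ⟨∑' d : ℕ, (ArithmeticFunction.moebius d : ℝ) / (d : ℝ) ^ 2, ?_, fun M hM => ?_⟩
  · have h1 := ArithmeticFunction.LSeries_zeta_mul_Lseries_moebius (s := 2) (by norm_num)
    rw [ArithmeticFunction.LSeries_zeta_eq_riemannZeta (by norm_num)] at h1
    rw [← eq_one_div_of_mul_eq_one_right h1, Complex.ofReal_tsum, LSeries]
    refine tsum_congr fun d => ?_
    rcases Nat.eq_zero_or_pos d with rfl | hd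
    · simp
    · rw [LSeries.term_of_ne_zero hd.ne']
      push_cast
      congr 1
      norm_cast
  · have htend := hsum.hasSum.tendsto_sum_nat
    have hM0 : (0 : ℝ) < M := by exact_mod_cast hM
    have hlim : Filter.Tendsto (fun n : ℕ =>
        |∑ d ∈ range (n + 1), (ArithmeticFunction.moebius d : ℝ) / (d : ℝ) ^ 2 -
          ∑ d ∈ Finset.Icc 1 M, (ArithmeticFunction.moebius d : ℝ) / (d : ℝ) ^ 2|)
        Filter.atTop (nhds |∑' d : ℕ, (ArithmeticFunction.moebius d : ℝ) / (d : ℝ) ^ 2 -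
          ∑ d ∈ Finset.Icc 1 M, (ArithmeticFunction.moebius d : ℝ) / (d : ℝ) ^ 2|) :=
      ((htend.comp (Filter.tendsto_add_atTop_nat 1)).sub_const _).abs
    refine le_of_tendsto hlim ?_
    filter_upwards [Filter.eventually_ge_atTop M] with n hn
    have e1 : ∑ d ∈ range (n + 1), (ArithmeticFunction.moebius d : ℝ) / (d : ℝ) ^ 2 -
        ∑ d ∈ Finset.Icc 1 M, (ArithmeticFunction.moebius d : ℝ) / (d : ℝ) ^ 2 =
        ∑ d ∈ Ioc M n, (ArithmeticFunction.moebius d : ℝ) / (d : ℝ) ^ 2 := by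
      have e2 : Finset.Icc 1 M = Ico 1 (M + 1) := by
        ext; simp only [Finset.mem_Icc, Finset.mem_Ico]; omega
      have e3 : Ioc M n = Ico (M + 1) (n + 1) := by
        ext; simp only [Finset.mem_Ioc, Finset.mem_Ico]; omega
      rw [e2, e3, range_eq_Ico, sum_eq_sum_Ico_succ_bot (by omega),
        ← sum_Ico_consecutive _ (by omega : 0 + 1 ≤ M + 1) (by omega : M + 1 ≤ n + 1)]
      simp
    rw [e1]
    calc |∑ d ∈ Ioc M n, (ArithmeticFunction.moebius d : ℝ) / (d : ℝ) ^ 2| ≤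
          ∑ d ∈ Ioc M n, ((d : ℝ) ^ 2)⁻¹ := by
          refine (abs_sum_le_sum_abs _ _).trans (sum_le_sum fun d _ => ?_)
          rw [abs_div, abs_of_nonneg (by positivity : (0 : ℝ) ≤ (d : ℝ) ^ 2), ← one_div]
          gcongr
          exact abs_moebius_le_one d
      _ ≤ (M : ℝ)⁻¹ - (n : ℝ)⁻¹ := sum_Ioc_inv_sq_le_sub (by omega) hn
      _ ≤ 1 / M := by
        have : (0 : ℝ) ≤ (n : ℝ)⁻¹ := by positivity
        rw [one_div]; linarith

/-! ### Summation over the divisors -/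

/-- The divisor bound on average over the sequence: `∑ N_d(X) ≪ X ^ (1 + η)`. -/
lemma sum_divCount_le {c : ℝ} (hc : 1 ≤ c) {C η : ℝ} (hC : 0 < C) (hη : 0 < η)
    (h : ∀ n : ℕ, 1 ≤ n → (#n.divisors : ℝ) ≤ C * (n : ℝ) ^ (η / c)) {X : ℕ} (hX : 1 ≤ X) (M : ℕ) :
    ∑ d ∈ Finset.Icc 1 M, (divCount c d X : ℝ) ≤ C * (X : ℝ) ^ (1 + η) := by
  have hX0 : (0 : ℝ) < X := by exact_mod_cast hX
  have h1 : ∑ d ∈ Finset.Icc 1 M, divCount c d X ≤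
      ∑ n ∈ Finset.Icc 1 X, #(piatetskiShapiro c n).divisors := by
    unfold divCount
    simp only [card_filter]
    rw [sum_comm]
    refine sum_le_sum fun n hn => ?_
    rw [Finset.mem_Icc] at hn
    rw [← card_filter]
    apply card_le_card
    intro d hd
    rw [mem_filter] at hd
    rw [Nat.mem_divisors]
    have := piatetskiShapiro_pos hc hn.1
    exact ⟨hd.2, by omega⟩
  calc ∑ d ∈ Finset.Icc 1 M, (divCount c d X : ℝ) ≤
        ∑ n ∈ Finset.Icc 1 X, (#(piatetskiShapiro c n).divisors : ℝ) := by exact_mod_cast h1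
    _ ≤ ∑ n ∈ Finset.Icc 1 X, C * (X : ℝ) ^ η := by
      refine sum_le_sum fun n hn => ?_
      rw [Finset.mem_Icc] at hn
      have hnX : (n : ℝ) ≤ X := by exact_mod_cast hn.2
      refine (h _ (piatetskiShapiro_pos hc hn.1)).trans ?_
      gcongr
      have h2 : (piatetskiShapiro c n : ℝ) ≤ (X : ℝ) ^ c :=
        (Nat.floor_le (by positivity)).trans (by gcongr)
      calc _ ≤ ((X : ℝ) ^ c) ^ (η / c) := by gcongr
        _ = _ := by
          rw [← Real.rpow_mul hX0.le]; congr 1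
          field_simp
    _ = C * (X : ℝ) ^ (1 + η) := by
      rw [sum_const, Nat.card_Icc, Nat.add_sub_cancel, nsmul_eq_mul, Real.rpow_add hX0,
        Real.rpow_one]
      ring

lemma sum_one_div_le {η c : ℝ} (hη : 0 < η) (hc : 0 < c) {X M : ℕ}
    (hM : (M : ℝ) ≤ (X : ℝ) ^ c) :
    ∑ d ∈ Finset.Icc 1 M, 1 / (d : ℝ) ≤
      (∑' d : ℕ, 1 / (d : ℝ) ^ (1 + η / c)) * (X : ℝ) ^ η := by
  have hs : Summable fun d : ℕ => 1 / (d : ℝ) ^ (1 + η / c) :=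
    Real.summable_one_div_nat_rpow.2 (by have : 0 < η / c := by positivity
                                         linarith)
  calc ∑ d ∈ Finset.Icc 1 M, 1 / (d : ℝ) ≤
        ∑ d ∈ Finset.Icc 1 M, 1 / (d : ℝ) ^ (1 + η / c) * (X : ℝ) ^ η := by
        refine sum_le_sum fun d hd => ?_
        rw [Finset.mem_Icc] at hd
        have hd0 : (0 : ℝ) < d := by exact_mod_cast hd.1
        have h1 : (d : ℝ) ^ (η / c) ≤ (X : ℝ) ^ η := by
          calc _ ≤ ((X : ℝ) ^ c) ^ (η / c) := by
                have : (d : ℝ) ≤ M := by exact_mod_cast hd.2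
                gcongr; linarith
            _ = _ := by
              rw [← Real.rpow_mul (Nat.cast_nonneg X)]; congr 1
              field_simp
        rw [Real.rpow_add hd0, Real.rpow_one, one_div_mul_eq_div, le_div_iff₀ (by positivity)]
        calc _ = (d : ℝ) ^ (η / c) := by field_simp
          _ ≤ _ := h1
    _ = (∑ d ∈ Finset.Icc 1 M, 1 / (d : ℝ) ^ (1 + η / c)) * (X : ℝ) ^ η := by rw [sum_mul]
    _ ≤ _ := by
      gcongr
      exact hs.sum_le_tsum _ fun d _ => by positivity

/-- The divisor counts weighted by `d ^ (-θ)`: for `d ≤ X ^ (δ / 2)` equidistribution is used, and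
larger `d` gain a power of `X` from the weight, which the divisor bound does not exhaust. -/
lemma rpow_neg_mul_divCount_le {c δ θ κ B : ℝ} (hθ : 0 < θ) (hκ : 0 < κ)
    (hB : 0 < B) {X d : ℕ} (hX : 1 ≤ X) (hd : 1 ≤ d)
    (h : |(divCount c d X : ℝ) - X / d| ≤
      B * ((d : ℝ) ^ (-θ) * (X : ℝ) ^ (1 - δ) + (X : ℝ) ^ (1 - δ - κ))) :
    (d : ℝ) ^ (-θ) * divCount c d X ≤ X * (1 / (d : ℝ) ^ (1 + θ)) +
      2 * B * X * (1 / (d : ℝ) ^ (2 : ℝ)) + (X : ℝ) ^ (-(δ * θ / 2)) * divCount c d X := by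
  have hX1 : (1 : ℝ) ≤ X := by exact_mod_cast hX
  have hX0 : (0 : ℝ) < X := by linarith
  have hd1 : (1 : ℝ) ≤ d := by exact_mod_cast hd
  have hd0 : (0 : ℝ) < d := by linarith
  have hN : (0 : ℝ) ≤ divCount c d X := Nat.cast_nonneg _
  have hw0 : 0 < (d : ℝ) ^ (-θ) := Real.rpow_pos_of_pos hd0 _
  have hw1 : (d : ℝ) ^ (-θ) ≤ 1 := Real.rpow_le_one_of_one_le_of_nonpos hd1 (by linarith)
  rcases le_or_gt (d : ℝ) ((X : ℝ) ^ (δ / 2)) with hs | hs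
  · have h1 : (divCount c d X : ℝ) ≤ X / d + 2 * B * (X : ℝ) ^ (1 - δ) := by
      have h2 := (abs_le.1 h).2
      have h3 : (X : ℝ) ^ (1 - δ - κ) ≤ (X : ℝ) ^ (1 - δ) :=
        Real.rpow_le_rpow_of_exponent_le hX1 (by linarith)
      have h4 : (d : ℝ) ^ (-θ) * (X : ℝ) ^ (1 - δ) ≤ (X : ℝ) ^ (1 - δ) :=
        mul_le_of_le_one_left (by positivity) hw1
      nlinarith
    have h5 : (X : ℝ) ^ (1 - δ) ≤ X * (1 / (d : ℝ) ^ (2 : ℝ)) := by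
      have h6 : (d : ℝ) ^ (2 : ℝ) ≤ (X : ℝ) ^ δ := by
        calc _ ≤ ((X : ℝ) ^ (δ / 2)) ^ (2 : ℝ) := by gcongr
          _ = _ := by rw [← Real.rpow_mul hX0.le]; congr 1; ring
      rw [mul_one_div, Real.rpow_sub hX0, Real.rpow_one]
      gcongr
    have h7 : (d : ℝ) ^ (-θ) * (X / d) = X * (1 / (d : ℝ) ^ (1 + θ)) := by
      rw [Real.rpow_neg hd0.le, Real.rpow_add hd0, Real.rpow_one]; field_simp
    calc (d : ℝ) ^ (-θ) * divCount c d X ≤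
          (d : ℝ) ^ (-θ) * (X / d + 2 * B * (X : ℝ) ^ (1 - δ)) := by gcongr
      _ = (d : ℝ) ^ (-θ) * (X / d) + (d : ℝ) ^ (-θ) * (2 * B * (X : ℝ) ^ (1 - δ)) := by ring
      _ ≤ X * (1 / (d : ℝ) ^ (1 + θ)) + 1 * (2 * B * (X * (1 / (d : ℝ) ^ (2 : ℝ)))) := by
        rw [h7]; gcongr
      _ ≤ X * (1 / (d : ℝ) ^ (1 + θ)) + 1 * (2 * B * (X * (1 / (d : ℝ) ^ (2 : ℝ)))) +
          (X : ℝ) ^ (-(δ * θ / 2)) * divCount c d X := le_add_of_nonneg_right (by positivity)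
      _ = _ := by ring
  · have h1 : (d : ℝ) ^ (-θ) ≤ (X : ℝ) ^ (-(δ * θ / 2)) := by
      calc _ ≤ ((X : ℝ) ^ (δ / 2)) ^ (-θ) :=
            Real.rpow_le_rpow_of_nonpos (by positivity) hs.le (by linarith)
        _ = _ := by rw [← Real.rpow_mul hX0.le]; congr 1; ring
    calc _ ≤ (X : ℝ) ^ (-(δ * θ / 2)) * divCount c d X := by gcongr
      _ ≤ _ := le_add_of_nonneg_left (by positivity)

/-- Equidistribution modulo every `d` implies the count of coprime pairs. -/
theorem exists_coprimePairCount_bound_nat {c δ θ κ B : ℝ} (hc : 1 ≤ c) (hδ : 0 < δ) (hδ1 : δ ≤ 1)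
    (hθ : 0 < θ) (hκ : 0 < κ) (hB : 0 < B)
    (h : ∀ X d : ℕ, 1 ≤ X → 1 ≤ d → |(divCount c d X : ℝ) - X / d| ≤
      B * ((d : ℝ) ^ (-θ) * (X : ℝ) ^ (1 - δ) + (X : ℝ) ^ (1 - δ - κ)))
    {m₀ : ℝ} (hm₀ : ∀ M : ℕ, 1 ≤ M →
      |m₀ - ∑ d ∈ Finset.Icc 1 M, (ArithmeticFunction.moebius d : ℝ) / (d : ℝ) ^ 2| ≤ 1 / M) :
    ∃ C : ℝ, 0 < C ∧ ∀ X : ℕ, 1 ≤ X →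
      |∑ d ∈ Finset.Icc 1 (piatetskiShapiro c X), (ArithmeticFunction.moebius d : ℝ) *
        (divCount c d X : ℝ) ^ 2 - m₀ * (X : ℝ) ^ 2| ≤ C * (X : ℝ) ^ (2 - δ) := by
  set η : ℝ := min κ (δ * θ / 2) with hη
  have hη0 : 0 < η := by positivity
  obtain ⟨C, hC, hdiv⟩ := exists_card_divisors_le (ε := η / c) (by positivity)
  set Z₁ := ∑' d : ℕ, 1 / (d : ℝ) ^ (1 + θ) with hZ₁
  set Z₂ := ∑' d : ℕ, 1 / (d : ℝ) ^ (2 : ℝ) with hZ₂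
  set Z₃ := ∑' d : ℕ, 1 / (d : ℝ) ^ (1 + η / c) with hZ₃
  have hs₁ : Summable fun d : ℕ => 1 / (d : ℝ) ^ (1 + θ) :=
    Real.summable_one_div_nat_rpow.2 (by linarith)
  have hs₂ : Summable fun d : ℕ => 1 / (d : ℝ) ^ (2 : ℝ) :=
    Real.summable_one_div_nat_rpow.2 (by norm_num)
  have hZ₁0 : 0 ≤ Z₁ := tsum_nonneg fun d => by positivity
  have hZ₂0 : 0 ≤ Z₂ := tsum_nonneg fun d => by positivity
  have hZ₃0 : 0 ≤ Z₃ := tsum_nonneg fun d => by positivity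
  refine ⟨B * ((Z₁ + 2 * B * Z₂ + C) + Z₁ + (C + Z₃)) + 2, by positivity, fun X hX => ?_⟩
  have hX1 : (1 : ℝ) ≤ X := by exact_mod_cast hX
  have hX0 : (0 : ℝ) < X := by linarith
  set M := piatetskiShapiro c X with hM
  have hM1 : 1 ≤ M := piatetskiShapiro_pos hc hX
  have hMX : (M : ℝ) ≤ (X : ℝ) ^ c := Nat.floor_le (by positivity)
  have hMX2 : (X : ℝ) ^ c ≤ 2 * M := by
    have h1 : (X : ℝ) ^ c < M + 1 := Nat.lt_floor_add_one _
    have h2 : (1 : ℝ) ≤ M := by exact_mod_cast hM1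
    linarith
  set S₁ := ∑ d ∈ Finset.Icc 1 M, (d : ℝ) ^ (-θ) * (divCount c d X : ℝ) with hS₁
  set S₂ := ∑ d ∈ Finset.Icc 1 M, (divCount c d X : ℝ) with hS₂
  set S₃ := ∑ d ∈ Finset.Icc 1 M, 1 / (d : ℝ) with hS₃
  set S₄ := ∑ d ∈ Finset.Icc 1 M, 1 / (d : ℝ) ^ (1 + θ) with hS₄
  have hS₂b : S₂ ≤ C * (X : ℝ) ^ (1 + η) := sum_divCount_le hc hC hη0 hdiv hX M
  have hS₃b : S₃ ≤ Z₃ * (X : ℝ) ^ η := sum_one_div_le hη0 (by linarith) hMX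
  have hS₄b : S₄ ≤ Z₁ := hs₁.sum_le_tsum _ fun d _ => by positivity
  have hS₁b : S₁ ≤ (Z₁ + 2 * B * Z₂ + C) * X := by
    have h1 : S₁ ≤ X * S₄ + 2 * B * X * ∑ d ∈ Finset.Icc 1 M, 1 / (d : ℝ) ^ (2 : ℝ) +
        (X : ℝ) ^ (-(δ * θ / 2)) * S₂ := by
      rw [hS₁, hS₂, hS₄, mul_sum, mul_sum, mul_sum, ← sum_add_distrib, ← sum_add_distrib]
      refine sum_le_sum fun d hd => ?_
      rw [Finset.mem_Icc] at hd
      exact rpow_neg_mul_divCount_le hθ hκ hB hX hd.1 (h X d hX hd.1)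
    have h2 : ∑ d ∈ Finset.Icc 1 M, 1 / (d : ℝ) ^ (2 : ℝ) ≤ Z₂ :=
      hs₂.sum_le_tsum _ fun d _ => by positivity
    have h3 : (X : ℝ) ^ (-(δ * θ / 2)) * S₂ ≤ C * X := by
      calc _ ≤ (X : ℝ) ^ (-η) * (C * (X : ℝ) ^ (1 + η)) := by
            gcongr
            exact min_le_right _ _
        _ = C * ((X : ℝ) ^ (-η) * (X : ℝ) ^ (1 + η)) := by ring
        _ = C * X := by
          rw [← Real.rpow_add hX0, show -η + (1 + η) = 1 by ring, Real.rpow_one]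
    calc S₁ ≤ _ := h1
      _ ≤ X * Z₁ + 2 * B * X * Z₂ + C * X := by gcongr
      _ = _ := by ring
  -- replace each count by its expected value
  have hmain : |∑ d ∈ Finset.Icc 1 M, (ArithmeticFunction.moebius d : ℝ) *
        (divCount c d X : ℝ) ^ 2 -
      (∑ d ∈ Finset.Icc 1 M, (ArithmeticFunction.moebius d : ℝ) / (d : ℝ) ^ 2) * (X : ℝ) ^ 2| ≤
      B * ((X : ℝ) ^ (1 - δ) * S₁ + (X : ℝ) ^ (1 - δ) * X * S₄ +
        (X : ℝ) ^ (1 - δ - κ) * (S₂ + X * S₃)) := by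
    rw [sum_mul, ← sum_sub_distrib]
    have e : B * ((X : ℝ) ^ (1 - δ) * S₁ + (X : ℝ) ^ (1 - δ) * X * S₄ +
        (X : ℝ) ^ (1 - δ - κ) * (S₂ + X * S₃)) = ∑ d ∈ Finset.Icc 1 M,
        B * ((X : ℝ) ^ (1 - δ) * ((d : ℝ) ^ (-θ) * (divCount c d X : ℝ)) +
          (X : ℝ) ^ (1 - δ) * X * (1 / (d : ℝ) ^ (1 + θ)) +
          (X : ℝ) ^ (1 - δ - κ) * ((divCount c d X : ℝ) + X * (1 / (d : ℝ)))) := by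
      rw [hS₁, hS₂, hS₃, hS₄]
      simp only [mul_sum, mul_add, sum_add_distrib]
    rw [e]
    refine (abs_sum_le_sum_abs _ _).trans (sum_le_sum fun d hd => ?_)
    rw [Finset.mem_Icc] at hd
    have hd0 : (0 : ℝ) < d := by exact_mod_cast hd.1
    have hN : (0 : ℝ) ≤ divCount c d X := Nat.cast_nonneg _
    have e2 : (ArithmeticFunction.moebius d : ℝ) * (divCount c d X : ℝ) ^ 2 -
        (ArithmeticFunction.moebius d : ℝ) / (d : ℝ) ^ 2 * (X : ℝ) ^ 2 =
        (ArithmeticFunction.moebius d : ℝ) * (((divCount c d X : ℝ) - X / d) *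
          ((divCount c d X : ℝ) + X / d)) := by
      field_simp
      ring
    have hpos : 0 ≤ (divCount c d X : ℝ) + X / d := by positivity
    rw [e2, abs_mul, abs_mul, abs_of_nonneg hpos]
    have h7 : (d : ℝ) ^ (-θ) * (X / d) = X * (1 / (d : ℝ) ^ (1 + θ)) := by
      rw [Real.rpow_neg hd0.le, Real.rpow_add hd0, Real.rpow_one]; field_simp
    calc _ ≤ 1 * (B * ((d : ℝ) ^ (-θ) * (X : ℝ) ^ (1 - δ) + (X : ℝ) ^ (1 - δ - κ)) *
          ((divCount c d X : ℝ) + X / d)) := by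
          gcongr
          · exact abs_moebius_le_one d
          · exact h X d hX hd.1
      _ = B * ((X : ℝ) ^ (1 - δ) * ((d : ℝ) ^ (-θ) * (divCount c d X : ℝ)) +
          (X : ℝ) ^ (1 - δ) * ((d : ℝ) ^ (-θ) * (X / d)) +
          (X : ℝ) ^ (1 - δ - κ) * ((divCount c d X : ℝ) + X * (1 / (d : ℝ)))) := by ring
      _ = _ := by rw [h7]; ring
  have hpow : (X : ℝ) ^ (1 - δ) * X = (X : ℝ) ^ (2 - δ) := by
    rw [show 2 - δ = (1 - δ) + 1 by ring, Real.rpow_add hX0, Real.rpow_one]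
  have hpow2 : (X : ℝ) ^ (1 - δ - κ) * (X * (X : ℝ) ^ η) ≤ (X : ℝ) ^ (2 - δ) := by
    nth_rewrite 2 [← Real.rpow_one (X : ℝ)]
    rw [← Real.rpow_add hX0, ← Real.rpow_add hX0]
    apply Real.rpow_le_rpow_of_exponent_le hX1
    have : η ≤ κ := min_le_left _ _
    linarith
  have hXη : (X : ℝ) ^ (1 + η) = X * (X : ℝ) ^ η := by rw [Real.rpow_add hX0, Real.rpow_one]
  rw [hXη] at hS₂b
  have htail : |(∑ d ∈ Finset.Icc 1 M, (ArithmeticFunction.moebius d : ℝ) / (d : ℝ) ^ 2) *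
      (X : ℝ) ^ 2 - m₀ * (X : ℝ) ^ 2| ≤ 2 * (X : ℝ) ^ (2 - δ) := by
    rw [← sub_mul, abs_mul, abs_sub_comm, abs_of_nonneg (by positivity : (0 : ℝ) ≤ (X : ℝ) ^ 2)]
    have h1 : (X : ℝ) ≤ 2 * M := by
      refine le_trans ?_ hMX2
      nth_rewrite 1 [← Real.rpow_one (X : ℝ)]
      exact Real.rpow_le_rpow_of_exponent_le hX1 hc
    have hM0 : (0 : ℝ) < M := by exact_mod_cast hM1
    calc _ ≤ 1 / (M : ℝ) * (X : ℝ) ^ 2 := by gcongr; exact hm₀ M hM1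
      _ ≤ 1 / (M : ℝ) * (X * (2 * M)) := by rw [sq]; gcongr
      _ = 2 * (X : ℝ) ^ (1 : ℝ) := by rw [Real.rpow_one]; field_simp
      _ ≤ _ := by gcongr; linarith
  have hfin : B * ((X : ℝ) ^ (1 - δ) * S₁ + (X : ℝ) ^ (1 - δ) * X * S₄ +
        (X : ℝ) ^ (1 - δ - κ) * (S₂ + X * S₃)) ≤
      B * ((Z₁ + 2 * B * Z₂ + C) + Z₁ + (C + Z₃)) * (X : ℝ) ^ (2 - δ) := by
    rw [mul_assoc B (_ + _ + (C + Z₃))]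
    refine mul_le_mul_of_nonneg_left ?_ hB.le
    calc _ ≤ (X : ℝ) ^ (1 - δ) * ((Z₁ + 2 * B * Z₂ + C) * X) + (X : ℝ) ^ (1 - δ) * X * Z₁ +
          (X : ℝ) ^ (1 - δ - κ) * (C * (X * (X : ℝ) ^ η) + X * (Z₃ * (X : ℝ) ^ η)) := by gcongr
      _ = (Z₁ + 2 * B * Z₂ + C) * ((X : ℝ) ^ (1 - δ) * X) + ((X : ℝ) ^ (1 - δ) * X) * Z₁ +
          (C + Z₃) * ((X : ℝ) ^ (1 - δ - κ) * (X * (X : ℝ) ^ η)) := by ring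
      _ ≤ (Z₁ + 2 * B * Z₂ + C) * (X : ℝ) ^ (2 - δ) + (X : ℝ) ^ (2 - δ) * Z₁ +
          (C + Z₃) * (X : ℝ) ^ (2 - δ) := by rw [hpow]; gcongr
      _ = _ := by ring
  calc _ ≤ _ := abs_sub_le _ ((∑ d ∈ Finset.Icc 1 M, (ArithmeticFunction.moebius d : ℝ) /
        (d : ℝ) ^ 2) * (X : ℝ) ^ 2) _
    _ ≤ B * ((Z₁ + 2 * B * Z₂ + C) + Z₁ + (C + Z₃)) * (X : ℝ) ^ (2 - δ) +
        2 * (X : ℝ) ^ (2 - δ) := add_le_add (hmain.trans hfin) htail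
    _ = _ := by ring

/-! ### The asymptotic formula -/

/-- `S_c(x) = x² / ζ(2) + O(x ^ e)` on `x ≥ 1`. -/
def CoprimeAsymptotic (c e : ℝ) : Prop :=
  ∃ C : ℝ, ∀ x : ℝ, 1 ≤ x →
    ‖(coprimePairCount c x : ℂ) - (1 / riemannZeta 2) * (x : ℂ) ^ 2‖ ≤ C * x ^ e

lemma CoprimeAsymptotic.mono {c e e' : ℝ} (h : CoprimeAsymptotic c e) (he : e ≤ e') :
    CoprimeAsymptotic c e' := by
  obtain ⟨C, hC⟩ := h
  refine ⟨|C|, fun x hx => (hC x hx).trans ?_⟩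
  have h1 := Real.rpow_le_rpow_of_exponent_le hx he
  have h2 : 0 ≤ x ^ e := Real.rpow_nonneg (by linarith) _
  exact mul_le_mul (le_abs_self C) h1 h2 (abs_nonneg C)

lemma coprimeAsymptotic_of_divCount_bound {c δ θ κ B : ℝ} (hc : 1 ≤ c) (hδ : 0 < δ) (hδ1 : δ ≤ 1)
    (hθ : 0 < θ) (hκ : 0 < κ) (hB : 0 < B)
    (h : ∀ X d : ℕ, 1 ≤ X → 1 ≤ d → |(divCount c d X : ℝ) - X / d| ≤
      B * ((d : ℝ) ^ (-θ) * (X : ℝ) ^ (1 - δ) + (X : ℝ) ^ (1 - δ - κ))) :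
    CoprimeAsymptotic c (2 - δ) := by
  obtain ⟨m₀, hm, hm₀⟩ := exists_moebius_sum
  obtain ⟨C, hC, hmain⟩ := exists_coprimePairCount_bound_nat hc hδ hδ1 hθ hκ hB h hm₀
  refine ⟨C + 2 * |m₀|, fun x hx => ?_⟩
  have hx0 : 0 < x := by linarith
  set X := ⌊x⌋₊ with hX
  have hX1 : 1 ≤ X := Nat.le_floor (by exact_mod_cast hx)
  have hXx : (X : ℝ) ≤ x := Nat.floor_le hx0.le
  have hxX : x < X + 1 := Nat.lt_floor_add_one x
  have e : (coprimePairCount c x : ℂ) - (1 / riemannZeta 2) * (x : ℂ) ^ 2 =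
      (((coprimePairCount c x : ℝ) - m₀ * x ^ 2 : ℝ) : ℂ) := by
    rw [← hm]; push_cast; ring
  rw [e, Complex.norm_real, Real.norm_eq_abs, coprimePairCount_eq_sum hc]
  have h1 := hmain X hX1
  have h2 : |m₀ * (X : ℝ) ^ 2 - m₀ * x ^ 2| ≤ |m₀| * (2 * x ^ (2 - δ)) := by
    rw [← mul_sub, abs_mul]
    gcongr
    have h3 : x ^ (1 : ℝ) ≤ x ^ (2 - δ) :=
      Real.rpow_le_rpow_of_exponent_le hx (by linarith)
    rw [Real.rpow_one] at h3
    have h4 : (1 : ℝ) ≤ X := by exact_mod_cast hX1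
    rw [abs_le]
    constructor <;> nlinarith
  have h5 : (X : ℝ) ^ (2 - δ) ≤ x ^ (2 - δ) := by gcongr; linarith
  calc _ ≤ _ := abs_sub_le _ (m₀ * (X : ℝ) ^ 2) _
    _ ≤ C * x ^ (2 - δ) + |m₀| * (2 * x ^ (2 - δ)) :=
      add_le_add (h1.trans (by gcongr)) h2
    _ = _ := by ring

lemma coprimeAsymptotic_one {δ : ℝ} (hδ : 0 < δ) (hδ1 : δ < 1) : CoprimeAsymptotic 1 (2 - δ) := by
  refine coprimeAsymptotic_of_divCount_bound le_rfl hδ hδ1.le one_pos (sub_pos.2 hδ1) one_pos ?_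
  intro X d hX hd
  have hd0 : (0 : ℝ) < d := by exact_mod_cast hd
  have e : divCount 1 d X = X / d := by
    have : ∀ n : ℕ, piatetskiShapiro 1 n = n := fun n => by simp [piatetskiShapiro]
    simp only [divCount, this]
    rw [← Nat.Ioc_filter_dvd_card_eq_div]
    rfl
  have h1 : (1 : ℝ) - δ - (1 - δ) = 0 := by ring
  rw [e, h1, Real.rpow_zero, one_mul]
  have h2 : ((X / d : ℕ) : ℝ) ≤ X / d := Nat.cast_div_le
  have h3 : (X : ℝ) / d < (X / d : ℕ) + 1 := by
    rw [div_lt_iff₀ hd0]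
    exact_mod_cast (Nat.lt_mul_of_div_lt (Nat.lt_succ_self _) hd).trans_le (by rw [mul_comm])
  have h4 : 0 ≤ (d : ℝ) ^ (-(1 : ℝ)) * (X : ℝ) ^ (1 - δ) := by positivity
  rw [abs_le]
  constructor <;> linarith

/-- For an integral exponent `m ≥ 1`, coprimality of `a ^ m` and `b ^ m` is that of `a` and `b`. -/
lemma coprimePairCount_natCast {m : ℕ} (hm : 1 ≤ m) (x : ℝ) :
    coprimePairCount m x = coprimePairCount 1 x := by
  have h1 : ∀ n : ℕ, piatetskiShapiro m n = n ^ m := fun n => by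
    rw [piatetskiShapiro, Real.rpow_natCast, ← Nat.cast_pow, Nat.floor_natCast]
  have h2 : ∀ n : ℕ, piatetskiShapiro 1 n = n := fun n => by simp [piatetskiShapiro]
  unfold coprimePairCount
  simp only [h1, h2, Nat.coprime_pow_left_iff hm, Nat.coprime_pow_right_iff hm]

/-- The exponent of the `k`-th derivative test, for `c` non-integral, as long as its second term
is of lower order. -/
lemma coprimeAsymptotic_of_sub_lt {c : ℝ} (hc : ∀ m : ℕ, c ≠ m) (hc1 : 1 ≤ c) (r : ℕ)
    (hck : c < (r + 2 : ℕ)) (hs : (r + 2 : ℕ) - c < 2 - 1 / (2 : ℝ) ^ (r + 1)) :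
    CoprimeAsymptotic c (2 - ((r + 2 : ℕ) - c) / (2 * (2 : ℝ) ^ (r + 1) - 1)) := by
  have hK2 := two_le_two_pow_succ r
  set K : ℝ := (2 : ℝ) ^ (r + 1) with hK
  have hK1 : 0 < 2 * K - 1 := by linarith
  set δ : ℝ := ((r + 2 : ℕ) - c) / (2 * K - 1) with hδ
  have hδ0 : 0 < δ := div_pos (by linarith) hK1
  have hδK : δ < 1 / K := by
    rw [hδ, div_lt_div_iff₀ hK1 (by linarith)]
    calc _ < (2 - 1 / K) * K := by gcongr
      _ = _ := by field_simp
  have hK1' : 1 / K ≤ 1 / 2 := one_div_le_one_div_of_le (by norm_num) hK2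
  have hκ : 0 < (1 / K - δ) / 2 := by linarith
  obtain ⟨B, hB, h⟩ := exists_divCount_bound hc hc1 r hck hκ
  refine coprimeAsymptotic_of_divCount_bound hc1 hδ0 (by linarith)
    (θ := 1 / (2 * K - 1)) (by positivity) hκ hB fun X d _ hd => ?_
  convert h X d hd using 4
  ring

/-- For larger `k` the exponent only gets worse: if `k - c ≥ 2 - 1/K`, where `K = 2 ^ (k - 1)`, then
`(k - c) / (2K - 1) ≤ (k - 1 - c) / (K - 1)`. -/
lemma coprimeAsymptotic_nonintegral {c : ℝ} (hc : ∀ m : ℕ, c ≠ m) (hc1 : 1 ≤ c) (r : ℕ)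
    (hck : c < (r + 2 : ℕ)) :
    CoprimeAsymptotic c (2 - ((r + 2 : ℕ) - c) / (2 * (2 : ℝ) ^ (r + 1) - 1)) := by
  induction r with
  | zero =>
    refine coprimeAsymptotic_of_sub_lt hc hc1 0 hck ?_
    norm_num; linarith
  | succ r ih =>
    rcases lt_or_ge (((r + 1 + 2 : ℕ) : ℝ) - c) (2 - 1 / (2 : ℝ) ^ (r + 1 + 1)) with hs | hs
    · exact coprimeAsymptotic_of_sub_lt hc hc1 (r + 1) hck hs
    · have hK2 := two_le_two_pow_succ r
      have hK' : (2 : ℝ) ^ (r + 1 + 1) = 2 * 2 ^ (r + 1) := by rw [pow_succ, mul_comm]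
      rw [hK'] at hs ⊢
      set K : ℝ := (2 : ℝ) ^ (r + 1) with hK
      have e : ((r + 1 + 2 : ℕ) : ℝ) = (r + 2 : ℕ) + 1 := by push_cast; ring
      have h1 : 1 / (2 * K) ≤ 1 / 4 := one_div_le_one_div_of_le (by norm_num) (by linarith)
      rw [e] at hs ⊢
      refine (ih (by linarith)).mono ?_
      apply sub_le_sub_left
      rw [div_le_div_iff₀ (by linarith) (by linarith)]
      have h2 := mul_le_mul_of_nonneg_right hs (by linarith : 0 ≤ 2 * K)
      have h3 : (2 - 1 / (2 * K)) * (2 * K) = 4 * K - 1 := by field_simp; ring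
      rw [h3] at h2
      linarith

lemma coprimeAsymptotic_of_lt {k : ℕ} {c : ℝ} (hk : 2 ≤ k) (hc : 1 ≤ c) (hck : c < k) :
    CoprimeAsymptotic c (2 - ((k : ℝ) - c) / ((2 : ℝ) ^ k - 1)) := by
  obtain ⟨r, rfl⟩ : ∃ r, k = r + 2 := ⟨k - 2, by omega⟩
  have hK : (2 : ℝ) ^ (r + 2) = 2 * 2 ^ (r + 1) := by ring
  rw [hK]
  by_cases hint : ∀ m : ℕ, c ≠ m
  · exact coprimeAsymptotic_nonintegral hint hc r hck
  · push Not at hint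
    obtain ⟨m, rfl⟩ := hint
    have hm : 1 ≤ m := by exact_mod_cast hc
    have h1 : ((r + 2 : ℕ) : ℝ) + 1 ≤ 2 * 2 ^ (r + 1) := by
      have : r + 2 + 1 ≤ 2 ^ (r + 2) := Nat.lt_two_pow_self
      rw [← hK]; exact_mod_cast this
    have hm1 : (1 : ℝ) ≤ m := hc
    have hpos : 0 < 2 * (2 : ℝ) ^ (r + 1) - 1 := by linarith [two_le_two_pow_succ r]
    unfold CoprimeAsymptotic
    simp only [coprimePairCount_natCast hm]
    exact coprimeAsymptotic_one (div_pos (by linarith) hpos)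
      ((div_lt_one hpos).2 (by linarith))

theorem mainTheorem2 :
    (∀ (k : ℕ) (c : ℝ), 2 ≤ k → 1 ≤ c → c < (k : ℝ) →
      ∃ C : ℝ, ∀ x : ℝ, 1 ≤ x →
        ‖(coprimePairCount c x : ℂ) - (1 / riemannZeta 2) * (x : ℂ) ^ 2‖ ≤
          C * x ^ ((2 : ℝ) - ((k : ℝ) - c) / ((2 : ℝ) ^ k - 1))) ∧
    (∀ c : ℝ, 1 ≤ c →
      ∃ C : ℝ, ∀ x : ℝ, 1 ≤ x →
        ‖(coprimePairCount c x : ℂ) - (1 / riemannZeta 2) * (x : ℂ) ^ 2‖ ≤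
          C * x ^ ((2 : ℝ) - (2 : ℝ) ^ (-((⌈c⌉ : ℝ) + 1)))) := by
  refine ⟨fun k c hk hc hck => coprimeAsymptotic_of_lt hk hc hck, fun c hc => ?_⟩
  -- the first claim with `k = ⌈c⌉ + 1`, for which `k - c ≥ 1`
  have hceil : ((⌈c⌉₊ : ℕ) : ℝ) = (⌈c⌉ : ℝ) := by
    rw [← natCast_ceil_eq_intCast_ceil (by linarith : 0 ≤ c)]
  have h1 : 1 ≤ ⌈c⌉₊ := Nat.one_le_ceil_iff.2 (by linarith)
  have h2 : c ≤ ⌈c⌉₊ := Nat.le_ceil c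
  refine (coprimeAsymptotic_of_lt (k := ⌈c⌉₊ + 1) (by omega) hc (by push_cast; linarith)).mono ?_
  apply sub_le_sub_left
  have hpow : (1 : ℝ) < 2 ^ (⌈c⌉₊ + 1) := one_lt_pow₀ (by norm_num) (by omega)
  have e : (2 : ℝ) ^ (-((⌈c⌉ : ℝ) + 1)) = 1 / 2 ^ (⌈c⌉₊ + 1) := by
    rw [← hceil, Real.rpow_neg (by norm_num), one_div]
    congr 1
    exact_mod_cast Real.rpow_natCast 2 (⌈c⌉₊ + 1)
  rw [e, div_le_div_iff₀ (by linarith) (by linarith)]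
  push_cast
  nlinarith
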